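/- Let $A$ be a (not necessarily commutative) ring with $1\neq 0$, let $\mathcal C$ be an $A$-coring with comultiplication $\Delta(c)=\sum c_1\otimes_A c_2$ and counit $\varepsilon$, and let $\mathbf x\in\mathcal C$ be a group-like element ($\Delta(\mathbf x)=\mathbf x\otimes_A\mathbf x$, $\varepsilon(\mathbf x)=1$). Let $\mathcal M^{\mathcal C}$ be the category of right $\mathcal C$-comodules, in which $A$ is an object via $A\to A\otimes_A\mathcal C\simeq\mathcal C$, $a\mapsto\mathbf x a$, and let $B=A^{co\mathcal C}=\{b\in A : b\mathbf x=\mathbf x b\}$. For $M\in\mathcal M^{\mathcal C}$ with coaction $\varrho(m)=\sum m_{<0>}\otimes_A m_{<1>}$ put $M^{co\mathcal C}=\{m\in M:\varrho(m)=m\otimes_A\mathbf x\}$ and consider $$\Psi_M: M^{co\mathcal C}\otimes_B A\to M,\ m\otimes a\mapsto ma,\qquad \Psi'_M:\mathrm{Hom}^{\mathcal C}(A,M)\otimes_B A\to M,\ f\otimes a\mapsto f(a).$$ The category $\mathcal M^{\mathcal C}$ satisfies the weak structure theorem if $\Psi_M$ is an isomorphism for every $M\in\mathcal M^{\mathcal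 C}$, and $A/B$ is $\mathcal C$-Galois if $\beta: A\otimes_B A\to\mathcal C$, $\tilde a\otimes a\mapsto\tilde a\,\mathbf x\,a$, is bijective. Let ${}^*\mathcal C=\mathrm{Hom}_{A-}(\mathcal C,A)$ be the ring of left $A$-linear maps with product $(f\cdot g)(c)=\sum g(c_1f(c_2))$ and unit $\varepsilon$; every right $\mathcal C$-comodule is a right ${}^*\mathcal C$-module via $mf=\sum m_{<0>}f(m_{<1>})$. For a right ${}^*\mathcal C$-module $W$, $\mathrm{Gen}(W)$ denotes the class of quotients of direct sums of copies of $W$, and $\sigma[W]$ the class of submodules of modules in $\mathrm{Gen}(W)$. A left $A$-module $W$ is locally projective if for every finitely generated submodule $F\subseteq W$, every epimorphism $\pi:L\to N$ and every homomorphism $g:W\to N$ of left $A$-modules there is a homomorphism $g':W\to L$ with $\pi g'|_F=g|_F$. Theorem. Let ${}_A\mathcal C$ be locally projective. Then the following are equivalent: 1. $\mathcal M^{\mathcal C}$ satisfies the weak structure theorem; 2. ${}_BA$ is flat and $A/B$ is $\mathcal C$-Galois; 3. ${}_BA$ is flat and $\Psi'_{\mathcal C}$ is an isomorphism; 4. ${}_BA$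 is flat, $\sigma[\mathcal C_{{}^*\mathcal C}]=\sigma[A_{{}^*\mathcal C}]$, and $\Psi'_M$ is bijective for every $A$-generated $M\in\mathcal M^{\mathcal C}$ (that is, every comodule $M$ whose underlying right ${}^*\mathcal C$-module lies in $\mathrm{Gen}(A_{{}^*\mathcal C})$); 5. $\Psi'_M$ is bijective for every $M\in\mathcal M^{\mathcal C}$; 6. $\sigma[\mathcal C_{{}^*\mathcal C}]=\mathrm{Gen}(A_{{}^*\mathcal C})$; 7. ${}_BA$ is flat, $\sigma[\mathcal C_{{}^*\mathcal C}]=\sigma[A_{{}^*\mathcal C}]$, and the functor $\mathrm{Hom}_{-{}^*\mathcal C}(A,-):\mathrm{Gen}(A_{{}^*\mathcal C})\to\mathcal M_B$ is full and faithful; 8. the functor $\mathrm{Hom}^{\mathcal C}(A,-):\mathcal M^{\mathcal C}\to\mathcal M_B$ is faithful; 9. $A$ is a generator in $\mathcal M^{\mathcal C}$. -/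

import Mathlib

open CategoryTheory MulOpposite

open scoped TensorProduct

universe u

/-! ## Tensor products over a not necessarily commutative ring

Right modules over `R` are modules over `Rᵐᵒᵖ`; `op r • m` stands for `m r`. -/

section BalTensor

variable (R : Type*) [Ring R] (M : Type*) [AddCommGroup M] [Module Rᵐᵒᵖ M]
  (N : Type*) [AddCommGroup N] [Module R N]

/-- The subgroup of `M ⊗[ℤ] N` generated by all `m r ⊗ n - m ⊗ r n`. -/
def BalTensor.relations : AddSubgroup (M ⊗[ℤ] N) :=
  AddSubgroup.closure
    {t | ∃ (m : M) (r : R) (n : N), t = (op r • m) ⊗ₜ[ℤ] n - m ⊗ₜ[ℤ] (r • n)}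

/-- The tensor product of a right `R`-module `M` and a left `R`-module `N`. -/
def BalTensor : Type _ := (M ⊗[ℤ] N) ⧸ BalTensor.relations R M N

noncomputable instance : AddCommGroup (BalTensor R M N) :=
  inferInstanceAs (AddCommGroup ((M ⊗[ℤ] N) ⧸ BalTensor.relations R M N))

end BalTensor

namespace BalTensor

variable {R : Type*} [Ring R] {M : Type*} [AddCommGroup M] [Module Rᵐᵒᵖ M]
  {N : Type*} [AddCommGroup N] [Module R N]
  {M' : Type*} [AddCommGroup M'] [Module Rᵐᵒᵖ M']
  {N' : Type*} [AddCommGroup N'] [Module R N']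
  {P : Type*} [AddCommGroup P]

variable (R M N) in
/-- The quotient map `M ⊗[ℤ] N → M ⊗ N`. -/
noncomputable def proj : M ⊗[ℤ] N →+ BalTensor R M N :=
  QuotientAddGroup.mk' (relations R M N)

theorem proj_surjective : Function.Surjective (proj R M N) :=
  QuotientAddGroup.mk'_surjective (relations R M N)

variable (R) in
/-- The elementary tensor `m ⊗ n`. -/
noncomputable def tmul (m : M) (n : N) : BalTensor R M N :=
  proj R M N (m ⊗ₜ[ℤ] n)

theorem tmul_add (m : M) (n n' : N) : tmul R m (n + n') = tmul R m n + tmul R m n' := by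
  simp only [tmul, TensorProduct.tmul_add, map_add]

theorem add_tmul (m m' : M) (n : N) : tmul R (m + m') n = tmul R m n + tmul R m' n := by
  simp only [tmul, TensorProduct.add_tmul, map_add]

@[simp]
theorem tmul_zero (m : M) : tmul R m (0 : N) = 0 := by
  simp only [tmul, TensorProduct.tmul_zero, map_zero]

@[simp]
theorem zero_tmul (n : N) : tmul R (0 : M) n = 0 := by
  simp only [tmul, TensorProduct.zero_tmul, map_zero]

theorem neg_tmul (m : M) (n : N) : tmul R (-m) n = -tmul R m n := by
  simp only [tmul, TensorProduct.neg_tmul, map_neg]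

theorem smul_tmul (r : R) (m : M) (n : N) : tmul R (op r • m) n = tmul R m (r • n) := by
  have h : (op r • m) ⊗ₜ[ℤ] n - m ⊗ₜ[ℤ] (r • n) ∈ relations R M N :=
    AddSubgroup.subset_closure ⟨m, r, n, rfl⟩
  have h2 : proj R M N ((op r • m) ⊗ₜ[ℤ] n - m ⊗ₜ[ℤ] (r • n)) = 0 :=
    (QuotientAddGroup.eq_zero_iff (N := relations R M N) _).2 h
  rwa [map_sub, sub_eq_zero] at h2

@[elab_as_elim]
theorem induction_on {motive : BalTensor R M N → Prop} (t : BalTensor R M N)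
    (zero : motive 0) (tmul : ∀ m n, motive (tmul R m n))
    (add : ∀ s t, motive s → motive t → motive (s + t)) : motive t := by
  obtain ⟨t, rfl⟩ := proj_surjective t
  induction t using TensorProduct.induction_on with
  | zero => rw [map_zero]; exact zero
  | tmul m n => exact tmul m n
  | add s t hs ht => rw [map_add]; exact add _ _ hs ht

theorem hom_ext {f g : BalTensor R M N →+ P} (h : ∀ m n, f (tmul R m n) = g (tmul R m n)) :
    f = g := by
  ext t
  induction t using induction_on with
  | zero => simp
  | tmul m n => exact h m n
  | add s t hs ht => simp [hs, ht]

/-- The universal property: a biadditive balanced map induces a map on the tensor product. -/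
noncomputable def lift (f : M →+ N →+ P) (hf : ∀ m (r : R) n, f (op r • m) n = f m (r • n)) :
    BalTensor R M N →+ P :=
  QuotientAddGroup.lift (relations R M N)
    (TensorProduct.liftAddHom f (fun z m n => by simp)) (by
      rw [relations, AddSubgroup.closure_le]
      rintro _ ⟨m, r, n, rfl⟩
      simp [hf])

@[simp]
theorem lift_tmul (f : M →+ N →+ P) (hf : ∀ m (r : R) n, f (op r • m) n = f m (r • n))
    (m : M) (n : N) : lift f hf (tmul R m n) = f m n := rfl

/-- The map `f ⊗ g`. -/
noncomputable def map (f : M →ₗ[Rᵐᵒᵖ] M') (g : N →ₗ[R] N') :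
    BalTensor R M N →+ BalTensor R M' N' :=
  lift (AddMonoidHom.mk' (fun m => AddMonoidHom.mk' (fun n => tmul R (f m) (g n))
      (fun a b => by simp [tmul_add]))
      (fun a b => by ext n; simp [add_tmul]))
    (fun m r n => by simp [smul_tmul])

@[simp]
theorem map_tmul (f : M →ₗ[Rᵐᵒᵖ] M') (g : N →ₗ[R] N') (m : M) (n : N) :
    map f g (tmul R m n) = tmul R (f m) (g n) := rfl

section LeftModule

variable {S : Type*} [Ring S] [Module S M] [SMulCommClass S Rᵐᵒᵖ M]

variable (R M) in
/-- Left multiplication by `s` as a right `R`-linear map. -/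
def leftMul (s : S) : M →ₗ[Rᵐᵒᵖ] M where
  toFun m := s • m
  map_add' := smul_add s
  map_smul' r m := smul_comm s r m

/-- If `M` is an `(S, R)`-bimodule, then `M ⊗ N` is a left `S`-module by `s (m ⊗ n) = s m ⊗ n`. -/
noncomputable instance instLeftModule : Module S (BalTensor R M N) where
  smul s := map (leftMul R M s) LinearMap.id
  smul_zero s := map_zero (map (leftMul R M s) LinearMap.id)
  smul_add s := map_add (map (leftMul R M s) LinearMap.id)
  one_smul t := DFunLike.congr_fun (f := map (leftMul R M (1 : S)) (LinearMap.id (M := N)))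
    (g := AddMonoidHom.id _) (hom_ext fun m n => by simp [leftMul]) t
  mul_smul r s t := DFunLike.congr_fun (f := map (leftMul R M (r * s)) (LinearMap.id (M := N)))
    (g := (map (leftMul R M r) LinearMap.id).comp (map (leftMul R M s) LinearMap.id))
    (hom_ext fun m n => by simp [leftMul, mul_smul]) t
  zero_smul t := DFunLike.congr_fun (f := map (leftMul R M (0 : S)) (LinearMap.id (M := N)))
    (g := 0) (hom_ext fun m n => by simp [leftMul]) t
  add_smul r s t := DFunLike.congr_fun (f := map (leftMul R M (r + s)) (LinearMap.id (M := N)))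
    (g := map (leftMul R M r) LinearMap.id + map (leftMul R M s) LinearMap.id)
    (hom_ext fun m n => by simp [leftMul, add_smul, add_tmul]) t

theorem left_smul_tmul (s : S) (m : M) (n : N) : s • tmul R m n = tmul R (s • m) n := rfl

end LeftModule

section RightModule

variable {T : Type*} [Ring T] [Module Tᵐᵒᵖ N] [SMulCommClass R Tᵐᵒᵖ N]

variable (R N) in
/-- Right multiplication by `t` as a left `R`-linear map. -/
def rightMul (t : Tᵐᵒᵖ) : N →ₗ[R] N where
  toFun n := t • n
  map_add' := smul_add t
  map_smul' r n := (smul_comm r t n).symm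

/-- If `N` is an `(R, T)`-bimodule, then `M ⊗ N` is a right `T`-module by `(m ⊗ n) t = m ⊗ n t`. -/
noncomputable instance instRightModule : Module Tᵐᵒᵖ (BalTensor R M N) where
  smul s := map LinearMap.id (rightMul R N s)
  smul_zero s := map_zero (map LinearMap.id (rightMul R N s))
  smul_add s := map_add (map LinearMap.id (rightMul R N s))
  one_smul t := DFunLike.congr_fun (f := map (LinearMap.id (M := M)) (rightMul R N (1 : Tᵐᵒᵖ)))
    (g := AddMonoidHom.id _) (hom_ext fun m n => by simp [rightMul]) t
  mul_smul r s t := DFunLike.congr_fun (f := map (LinearMap.id (M := M)) (rightMul R N (r * s)))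
    (g := (map LinearMap.id (rightMul R N r)).comp (map LinearMap.id (rightMul R N s)))
    (hom_ext fun m n => by simp [rightMul, mul_smul]) t
  zero_smul t := DFunLike.congr_fun (f := map (LinearMap.id (M := M)) (rightMul R N (0 : Tᵐᵒᵖ)))
    (g := 0) (hom_ext fun m n => by simp [rightMul]) t
  add_smul r s t := DFunLike.congr_fun (f := map (LinearMap.id (M := M)) (rightMul R N (r + s)))
    (g := map LinearMap.id (rightMul R N r) + map LinearMap.id (rightMul R N s))
    (hom_ext fun m n => by simp [rightMul, add_smul, tmul_add]) t

theorem right_smul_tmul (t : Tᵐᵒᵖ) (m : M) (n : N) : t • tmul R m n = tmul R m (t • n) := rfl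

end RightModule

section Assoc

variable {S : Type*} [Ring S] [Module Sᵐᵒᵖ N] [SMulCommClass R Sᵐᵒᵖ N] [Module S P]

/-- The biadditive map `(m ⊗ n, p) ↦ m ⊗ (n ⊗ p)`. -/
noncomputable def assocAux : BalTensor R M N →+ P →+ BalTensor R M (BalTensor S N P) :=
  lift
    (AddMonoidHom.mk' (fun m => AddMonoidHom.mk' (fun n => AddMonoidHom.mk'
          (fun p => tmul R m (tmul S n p))
          (fun a b => by simp only [tmul_add]))
        (fun a b => by ext p; simp [tmul_add, add_tmul]))
      (fun a b => by ext n p; simp [add_tmul]))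
    (fun m r n => by ext p; simp [smul_tmul, left_smul_tmul])

theorem assocAux_smul (t : BalTensor R M N) (s : S) (p : P) :
    assocAux (S := S) (op s • t) p = assocAux (S := S) t (s • p) := by
  have h : ((AddMonoidHom.eval p).comp
        (assocAux (R := R) (M := M) (N := N) (S := S) (P := P))).comp
          (map LinearMap.id (rightMul R N (op s))) =
      (AddMonoidHom.eval (s • p)).comp (assocAux (R := R) (M := M) (N := N) (S := S) (P := P)) :=
    hom_ext fun m n => congrArg (tmul R m) (smul_tmul s n p)
  exact DFunLike.congr_fun h t

/-- The canonical map `(M ⊗ N) ⊗ P → M ⊗ (N ⊗ P)` (an isomorphism) for an `(R, S)`-bimodule `N`. -/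
noncomputable def assoc :
    BalTensor S (BalTensor R M N) P →+ BalTensor R M (BalTensor S N P) :=
  lift assocAux (fun t s p => assocAux_smul t s p)

@[simp]
theorem assoc_tmul (m : M) (n : N) (p : P) :
    assoc (tmul S (tmul R m n) p) = tmul R m (tmul S n p) := rfl

end Assoc

/-- For a left linear `g : N → R`, the map `M ⊗ N → M`, `m ⊗ n ↦ m g(n)`. -/
noncomputable def contractRight (g : N →ₗ[R] R) : BalTensor R M N →+ M :=
  lift (AddMonoidHom.mk' (fun m => AddMonoidHom.mk' (fun n => op (g n) • m)
      (fun a b => by simp [add_smul]))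
      (fun a b => by ext n; simp))
    (fun m r n => by simp [mul_smul])

@[simp]
theorem contractRight_tmul (g : N →ₗ[R] R) (m : M) (n : N) :
    contractRight g (tmul R m n) = op (g n) • m := rfl

/-- For a right linear `f : M → R`, the map `M ⊗ N → N`, `m ⊗ n ↦ f(m) n`. -/
noncomputable def contractLeft (f : M →ₗ[Rᵐᵒᵖ] R) : BalTensor R M N →+ N :=
  lift (AddMonoidHom.mk' (fun m => AddMonoidHom.mk' (fun n => f m • n)
      (fun a b => by simp))
      (fun a b => by ext n; simp [add_smul]))
    (fun m r n => by simp [mul_smul])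

@[simp]
theorem contractLeft_tmul (f : M →ₗ[Rᵐᵒᵖ] R) (m : M) (n : N) :
    contractLeft f (tmul R m n) = f m • n := rfl

end BalTensor

/-! ## Module-theoretic notions over a noncommutative ring -/

/-- The left `R`-module `N` is flat: `- ⊗ N` preserves injectivity of maps of right `R`-modules. -/
def LeftFlat (R : Type u) [Ring R] (N : Type u) [AddCommGroup N] [Module R N] : Prop :=
  ∀ (X Y : Type u) [AddCommGroup X] [Module Rᵐᵒᵖ X] [AddCommGroup Y] [Module Rᵐᵒᵖ Y]
    (f : X →ₗ[Rᵐᵒᵖ] Y), Function.Injective f →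
      Function.Injective (BalTensor.map f (LinearMap.id : N →ₗ[R] N))

/-- Local projectivity in the sense of Zimmermann-Huisgen: every `g : W → N` can be lifted along
every epimorphism `π : L → N` on any given finitely generated submodule of `W`. -/
def LocallyProjective (R : Type u) [Ring R] (W : Type u) [AddCommGroup W] [Module R W] : Prop :=
  ∀ (F : Submodule R W), F.FG →
    ∀ (L N : Type u) [AddCommGroup L] [Module R L] [AddCommGroup N] [Module R N]
      (π : L →ₗ[R] N) (g : W →ₗ[R] N), Function.Surjective π →
        ∃ g' : W →ₗ[R] L, ∀ w ∈ F, π (g' w) = g w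

section GenSigma

variable {R : Type u} [Ring R]

/-- `Gen(W)`: the modules that are quotients of direct sums of copies of `W`. -/
def Gen (W : ModuleCat.{u} R) : ObjectProperty (ModuleCat.{u} R) :=
  fun X => ∃ (Λ : Type u) (p : (Λ →₀ W) →ₗ[R] X), Function.Surjective p

/-- `σ[W]`: the modules that embed into a `W`-generated module. -/
def Subgen (W : ModuleCat.{u} R) : ObjectProperty (ModuleCat.{u} R) :=
  fun X => ∃ (Y : ModuleCat.{u} R) (i : X →ₗ[R] Y), Gen W Y ∧ Function.Injective i

end GenSigma

/-! ## Corings, comodules -/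

/-- An `A`-coring structure on the `A`-bimodule `C`. -/
structure Coring (A : Type u) [Ring A] (C : Type u) [AddCommGroup C] [Module A C]
    [Module Aᵐᵒᵖ C] [SMulCommClass A Aᵐᵒᵖ C] where
  /-- the comultiplication `Δ : C → C ⊗ C` -/
  comul : C →ₗ[A] BalTensor A C C
  comul_op_smul : ∀ (a : Aᵐᵒᵖ) (c : C), comul (a • c) = a • comul c
  /-- the counit `ε : C → A` -/
  counit : C →ₗ[A] A
  counit_op_smul : ∀ (a : Aᵐᵒᵖ) (c : C), counit (a • c) = a • counit c
  coassoc : ∀ c : C,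
    BalTensor.assoc (BalTensor.map
        (⟨⟨comul, comul.map_add⟩, comul_op_smul⟩ : C →ₗ[Aᵐᵒᵖ] BalTensor A C C)
        (LinearMap.id : C →ₗ[A] C) (comul c)) =
      BalTensor.map (LinearMap.id : C →ₗ[Aᵐᵒᵖ] C) comul (comul c)
  /-- `∑ ε(c₁) c₂ = c` -/
  counit_left : ∀ c : C,
    BalTensor.contractLeft (⟨⟨counit, counit.map_add⟩, counit_op_smul⟩ : C →ₗ[Aᵐᵒᵖ] A)
      (comul c) = c
  /-- `∑ c₁ ε(c₂) = c` -/
  counit_right : ∀ c : C, BalTensor.contractRight counit (comul c) = c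

section Comodules

variable {A : Type u} [Ring A] {C : Type u} [AddCommGroup C] [Module A C]
  [Module Aᵐᵒᵖ C] [SMulCommClass A Aᵐᵒᵖ C]

/-- Group-like elements: `Δ(x) = x ⊗ x` and `ε(x) = 1`. -/
structure Coring.IsGrouplike (𝒞 : Coring A C) (x : C) : Prop where
  comul_eq : 𝒞.comul x = BalTensor.tmul A x x
  counit_eq : 𝒞.counit x = 1

/-- Right comodules over a coring. -/
structure Comod (𝒞 : Coring A C) where
  /-- the underlying right `A`-module -/
  carrier : Type u
  [addCommGroup : AddCommGroup carrier]
  [module : Module Aᵐᵒᵖ carrier]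
  /-- the coaction `ϱ : M → M ⊗ C` -/
  coact : carrier →ₗ[Aᵐᵒᵖ] BalTensor A carrier C
  coassoc : ∀ m : carrier,
    BalTensor.assoc (BalTensor.map coact (LinearMap.id : C →ₗ[A] C) (coact m)) =
      BalTensor.map (LinearMap.id : carrier →ₗ[Aᵐᵒᵖ] carrier) 𝒞.comul (coact m)
  /-- `∑ m₀ ε(m₁) = m` -/
  counit : ∀ m : carrier, BalTensor.contractRight 𝒞.counit (coact m) = m

namespace Comod

variable {𝒞 : Coring A C}

instance : CoeSort (Comod 𝒞) (Type u) := ⟨Comod.carrier⟩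

instance (M : Comod 𝒞) : AddCommGroup M := M.addCommGroup

instance (M : Comod 𝒞) : Module Aᵐᵒᵖ M := M.module

/-- The group of `𝒞`-colinear maps `f : M → N`: right `A`-linear with `ϱ ∘ f = (f ⊗ 1) ∘ ϱ`. -/
def colinear (M N : Comod 𝒞) : AddSubgroup (M →ₗ[Aᵐᵒᵖ] N) where
  carrier := {f | ∀ m : M,
    N.coact (f m) = BalTensor.map f (LinearMap.id : C →ₗ[A] C) (M.coact m)}
  zero_mem' m := by
    have h : BalTensor.map (0 : M →ₗ[Aᵐᵒᵖ] N) (LinearMap.id : C →ₗ[A] C) = 0 :=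
      BalTensor.hom_ext fun m c => by simp
    simp [h]
  add_mem' {f g} hf hg m := by
    have h : BalTensor.map (f + g) (LinearMap.id : C →ₗ[A] C) =
        BalTensor.map f LinearMap.id + BalTensor.map g LinearMap.id :=
      BalTensor.hom_ext fun m c => by simp [BalTensor.add_tmul]
    have h1 := hf m
    have h2 := hg m
    simp [h, h1, h2]
  neg_mem' {f} hf m := by
    have h : BalTensor.map (-f) (LinearMap.id : C →ₗ[A] C) = -BalTensor.map f LinearMap.id :=
      BalTensor.hom_ext fun m c => by simp [BalTensor.neg_tmul]
    have h1 := hf m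
    simp [h, h1]

/-- The category `M^𝒞` of right `𝒞`-comodules and colinear maps. -/
instance : Category.{u} (Comod 𝒞) where
  Hom M N := colinear M N
  id M := ⟨LinearMap.id, fun m => by
    have h : BalTensor.map (LinearMap.id : M →ₗ[Aᵐᵒᵖ] M) (LinearMap.id : C →ₗ[A] C) =
        AddMonoidHom.id _ := BalTensor.hom_ext fun m c => by simp
    simp [h]⟩
  comp {M N P} f g := ⟨g.1.comp f.1, fun m => by
    have h : BalTensor.map (g.1.comp f.1) (LinearMap.id : C →ₗ[A] C) =
        (BalTensor.map g.1 LinearMap.id).comp (BalTensor.map f.1 LinearMap.id) :=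
      BalTensor.hom_ext fun m c => by simp
    have h1 := f.2 m
    have h2 := g.2 (f.1 m)
    simp [h, h2, h1]⟩

instance : Preadditive (Comod 𝒞) where
  homGroup M N := inferInstanceAs (AddCommGroup (colinear M N))
  add_comp _ _ _ _ _ h := Subtype.ext (LinearMap.comp_add _ _ h.1)
  comp_add _ _ _ _ _ _ := Subtype.ext (LinearMap.add_comp _ _ _)

end Comod

/-! ## The dual ring and its action on comodules -/

/-- The left dual `*C = Hom_A(C, A)` of left `A`-linear maps. -/
def Coring.Dual (_𝒞 : Coring A C) : Type u := C →ₗ[A] A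

/-- An element of the dual as a linear map. -/
def Coring.Dual.toLin {𝒞 : Coring A C} (f : 𝒞.Dual) : C →ₗ[A] A := f

namespace Comod

variable {𝒞 : Coring A C}

instance : AddCommGroup 𝒞.Dual := inferInstanceAs (AddCommGroup (C →ₗ[A] A))

/-- The coring as a right comodule over itself. -/
noncomputable def regular (𝒞 : Coring A C) : Comod 𝒞 where
  carrier := C
  coact := ⟨⟨𝒞.comul, 𝒞.comul.map_add⟩, 𝒞.comul_op_smul⟩
  coassoc := 𝒞.coassoc
  counit := 𝒞.counit_right

/-- The action `m ↼ f = ∑ m₀ f(m₁)` of the dual on a comodule. -/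
noncomputable def act (M : Comod 𝒞) (f : 𝒞.Dual) : M →+ M :=
  (BalTensor.contractRight f.toLin).comp M.coact.toAddMonoidHom

/-- The map `C → C`, `c ↦ ∑ c₁ f(c₂)`, as a left `A`-linear map. -/
noncomputable def actLin (f : 𝒞.Dual) : C →ₗ[A] C where
  toFun c := (regular 𝒞).act f c
  map_add' := map_add _
  map_smul' a c := by
    have h : (BalTensor.contractRight f.toLin).comp
          (BalTensor.map (BalTensor.leftMul A C a) LinearMap.id) =
        (DistribSMul.toAddMonoidHom C a).comp (BalTensor.contractRight (M := C) f.toLin) :=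
      BalTensor.hom_ext fun m n => (smul_comm a (op (f.toLin n)) m).symm
    have h1 : 𝒞.comul (a • c) =
        BalTensor.map (BalTensor.leftMul A C a) LinearMap.id (𝒞.comul c) := 𝒞.comul.map_smul a c
    change BalTensor.contractRight f.toLin (𝒞.comul (a • c)) = _
    rw [h1]
    exact DFunLike.congr_fun h (𝒞.comul c)

/-- The product of the dual: `(f · g)(c) = ∑ g(c₁ f(c₂))`. -/
noncomputable instance : Mul 𝒞.Dual := ⟨fun f g => (g.toLin.comp (actLin f) : C →ₗ[A] A)⟩

/-- The unit of the dual is the counit. -/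
instance : One 𝒞.Dual := ⟨𝒞.counit⟩

theorem act_one (M : Comod 𝒞) (m : M) : M.act 1 m = m := M.counit m

theorem coact_act (M : Comod 𝒞) (f : 𝒞.Dual) (m : M) :
    M.coact (M.act f m) =
      BalTensor.map (LinearMap.id : M →ₗ[Aᵐᵒᵖ] M) (actLin f) (M.coact m) := by
  have h1 : M.coact.toAddMonoidHom.comp (BalTensor.contractRight f.toLin) =
      ((BalTensor.map (LinearMap.id : M →ₗ[Aᵐᵒᵖ] M)
        (LinearMap.id : C →ₗ[A] C)).comp (BalTensor.contractRight
          f.toLin)).comp (BalTensor.map M.coact (LinearMap.id : C →ₗ[A] C)) :=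
    BalTensor.hom_ext fun m c => by
      have h : BalTensor.map (LinearMap.id : M →ₗ[Aᵐᵒᵖ] M) (LinearMap.id : C →ₗ[A] C) =
        AddMonoidHom.id _ := BalTensor.hom_ext fun m c => by simp
      rw [h]
      exact M.coact.map_smul _ _
  have h2 : ∀ t : BalTensor A (BalTensor A M C) C,
      BalTensor.contractRight f.toLin t =
        BalTensor.map (LinearMap.id : M →ₗ[Aᵐᵒᵖ] M)
          (⟨⟨BalTensor.contractRight f.toLin, map_add _⟩, fun a t => by
            have h : (BalTensor.contractRight f.toLin).comp
                (BalTensor.map (BalTensor.leftMul A C a) LinearMap.id) =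
              (DistribSMul.toAddMonoidHom C a).comp
                (BalTensor.contractRight (M := C) f.toLin) :=
              BalTensor.hom_ext fun m n => (smul_comm a (op (f.toLin n)) m).symm
            exact DFunLike.congr_fun h t⟩ : BalTensor A C C →ₗ[A] C) (BalTensor.assoc t) := by
    intro t
    induction t using BalTensor.induction_on with
    | zero => simp
    | add s t hs ht => rw [map_add, map_add, map_add, hs, ht]
    | tmul t c =>
      induction t using BalTensor.induction_on with
      | zero => simp
      | add s t hs ht => rw [BalTensor.add_tmul, map_add, map_add, map_add, hs, ht]
      | tmul m c' => rfl
  have h3 := DFunLike.congr_fun h1 (M.coact m)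
  have h : BalTensor.map (LinearMap.id : M →ₗ[Aᵐᵒᵖ] M) (LinearMap.id : C →ₗ[A] C) =
    AddMonoidHom.id _ := BalTensor.hom_ext fun m c => by simp
  rw [h] at h3
  refine h3.trans ((h2 _).trans ?_)
  refine (congrArg _ (M.coassoc m)).trans ?_
  generalize M.coact m = t
  induction t using BalTensor.induction_on with
  | zero => simp
  | tmul m c => rfl
  | add s t hs ht => rw [map_add, map_add, map_add, hs, ht]

theorem act_mul (M : Comod 𝒞) (f g : 𝒞.Dual) (m : M) :
    M.act (f * g) m = M.act g (M.act f m) := by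
  change _ = BalTensor.contractRight g.toLin (M.coact (M.act f m))
  rw [coact_act]
  change BalTensor.contractRight (f * g : 𝒞.Dual).toLin (M.coact m) = _
  generalize M.coact m = t
  induction t using BalTensor.induction_on with
  | zero => simp
  | tmul m c => rfl
  | add s t hs ht => rw [map_add, map_add, map_add, hs, ht]

theorem act_add (M : Comod 𝒞) (f g : 𝒞.Dual) (m : M) :
    M.act (f + g) m = M.act f m + M.act g m := by
  change BalTensor.contractRight (f.toLin + g.toLin) (M.coact m) =
    BalTensor.contractRight f.toLin (M.coact m) +
      BalTensor.contractRight g.toLin (M.coact m)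
  generalize M.coact m = t
  induction t using BalTensor.induction_on with
  | zero => simp
  | tmul m c => exact add_smul (op (f.toLin c)) (op (g.toLin c)) m
  | add s t hs ht => rw [map_add, map_add, map_add, hs, ht]; abel

theorem act_zero (M : Comod 𝒞) (m : M) : M.act 0 m = 0 := by
  have h := M.act_add 0 0 m
  rw [add_zero] at h
  simpa using h

/-- The ring `*C`, with product `(f · g)(c) = ∑ g(c₁ f(c₂))` and unit `ε`. -/
noncomputable instance : Ring 𝒞.Dual where
  __ := (inferInstance : AddCommGroup 𝒞.Dual)
  left_distrib f g h := LinearMap.ext fun c => rfl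
  right_distrib f g h := LinearMap.ext fun c => by
    change h.toLin ((regular 𝒞).act (f + g) c) = h.toLin ((regular 𝒞).act f c) +
      h.toLin ((regular 𝒞).act g c)
    exact (congrArg h.toLin ((regular 𝒞).act_add f g c)).trans (LinearMap.map_add _ _ _)
  zero_mul f := LinearMap.ext fun c => by
    change f.toLin ((regular 𝒞).act 0 c) = 0
    exact (congrArg f.toLin ((regular 𝒞).act_zero c)).trans (LinearMap.map_zero _)
  mul_zero f := rfl
  mul_assoc f g h := LinearMap.ext fun c =>
    congrArg h.toLin ((regular 𝒞).act_mul f g c)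
  one_mul f := LinearMap.ext fun c => congrArg f.toLin ((regular 𝒞).act_one c)
  mul_one f := LinearMap.ext fun c => by
    change 𝒞.counit ((regular 𝒞).act f c) = f.toLin c
    have h : 𝒞.counit.toAddMonoidHom.comp (BalTensor.contractRight f.toLin) =
        f.toLin.toAddMonoidHom.comp (BalTensor.contractLeft
          (⟨⟨𝒞.counit, 𝒞.counit.map_add⟩, 𝒞.counit_op_smul⟩ : C →ₗ[Aᵐᵒᵖ] A)) :=
      BalTensor.hom_ext fun c d =>
        (𝒞.counit_op_smul (op (f.toLin d)) c).trans (f.toLin.map_smul (𝒞.counit c) d).symm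
    exact (DFunLike.congr_fun h (𝒞.comul c)).trans
      (congrArg f.toLin (𝒞.counit_left c))

/-- A right `𝒞`-comodule is a right `*C`-module via `m ↼ f = ∑ m₀ f(m₁)`. -/
noncomputable instance (M : Comod 𝒞) : Module 𝒞.Dualᵐᵒᵖ M where
  smul f m := M.act f.unop m
  one_smul := M.act_one
  mul_smul f g m := M.act_mul g.unop f.unop m
  smul_zero f := map_zero (M.act f.unop)
  smul_add f := map_add (M.act f.unop)
  add_smul f g m := M.act_add f.unop g.unop m
  zero_smul := M.act_zero

/-- The right `*C`-module underlying a right `𝒞`-comodule. -/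
noncomputable def toModule (M : Comod 𝒞) : ModuleCat.{u} 𝒞.Dualᵐᵒᵖ := ModuleCat.of 𝒞.Dualᵐᵒᵖ M

/-- Colinear maps are `*C`-linear. -/
noncomputable def toModuleHom {M N : Comod 𝒞} (f : M ⟶ N) : M.toModule ⟶ N.toModule :=
  ModuleCat.ofHom
    { toFun := f.1
      map_add' := f.1.map_add
      map_smul' := fun g m => by
        change f.1 (M.act g.unop m) = N.act g.unop (f.1 m)
        have h2 := f.2 m
        change _ = BalTensor.contractRight g.unop.toLin (N.coact (f.1 m))
        rw [h2]
        change f.1 (BalTensor.contractRight g.unop.toLin (M.coact m)) = _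
        generalize M.coact m = t
        induction t using BalTensor.induction_on with
        | zero => simp
        | tmul m c => exact f.1.map_smul _ _
        | add s t hs ht => rw [map_add, map_add, map_add, map_add, hs, ht] }

end Comod

/-! ## Coinvariants and the structure maps -/

namespace Coring

/-- The subring `B = {b ∈ A | b x = x b}` of `A`. -/
def coinvariants (_𝒞 : Coring A C) (x : C) : Subring A where
  carrier := {b | b • x = op b • x}
  one_mem' := by simp
  zero_mem' := by simp
  add_mem' {a b} ha hb := by
    change (a + b) • x = op (a + b) • x
    change a • x = _ at ha
    change b • x = _ at hb
    rw [add_smul, ha, hb, MulOpposite.op_add, add_smul]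
  neg_mem' {a} ha := by
    change (-a) • x = op (-a) • x
    change a • x = _ at ha
    rw [neg_smul, ha, MulOpposite.op_neg, neg_smul]
  mul_mem' {a b} ha hb := by
    change (a * b) • x = op (a * b) • x
    change a • x = _ at ha
    change b • x = _ at hb
    rw [mul_smul, hb, smul_comm, ha, MulOpposite.op_mul, mul_smul]

variable (𝒞 : Coring A C) {x : C}

/-- `A` as a right `𝒞`-comodule with coaction `a ↦ 1 ⊗ x a`. -/
noncomputable def base (hx : 𝒞.IsGrouplike x) : Comod 𝒞 where
  carrier := A
  coact :=
    { toFun := fun a => BalTensor.tmul A 1 (op a • x)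
      map_add' := fun a b => by rw [MulOpposite.op_add, add_smul, BalTensor.tmul_add]
      map_smul' := fun r a => by
        change _ = r • BalTensor.tmul A 1 (op a • x)
        rw [BalTensor.right_smul_tmul, ← mul_smul]
        rfl }
  coassoc a := by
    simp [𝒞.comul_op_smul, hx.comul_eq, BalTensor.right_smul_tmul]
  counit a := by
    simp [𝒞.counit_op_smul, hx.counit_eq]

/-- Left multiplication by elements of `B`, as a ring homomorphism from `B` to the ring of
endomorphisms of `A` in `M^𝒞` (whose product is composition `f * g = f ∘ g`). -/
noncomputable def leftMulHom (hx : 𝒞.IsGrouplike x) :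
    𝒞.coinvariants x →+* End (𝒞.base hx) where
  toFun b := ⟨(BalTensor.leftMul A A (b : A) : A →ₗ[Aᵐᵒᵖ] A), fun (a : A) => by
    change BalTensor.tmul A (1 : A) (op ((b : A) * a) • x) =
      BalTensor.tmul A ((b : A) * 1) (op a • x)
    have h := BalTensor.smul_tmul (M := A) (b : A) 1 (op a • x)
    have hb : (b : A) • x = op (b : A) • x := b.2
    rw [smul_comm, hb, op_smul_eq_mul, one_mul] at h
    rw [mul_one, h, MulOpposite.op_mul, mul_smul]⟩
  map_one' := Subtype.ext (LinearMap.ext fun a => one_mul (M := A) a)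
  map_mul' b c := Subtype.ext (LinearMap.ext fun a => mul_assoc (G := A) b c a)
  map_zero' := Subtype.ext (LinearMap.ext fun a => zero_mul (M₀ := A) a)
  map_add' b c := Subtype.ext (LinearMap.ext fun a => add_mul (R := A) b c a)

/-- Left multiplication by elements of `B`, as a ring homomorphism from `B` to the ring of
endomorphisms of the right `*C`-module `A`. -/
noncomputable def leftMulModuleHom (hx : 𝒞.IsGrouplike x) :
    𝒞.coinvariants x →+* End (𝒞.base hx).toModule where
  toFun b := Comod.toModuleHom (𝒞.leftMulHom hx b)
  map_one' := ModuleCat.hom_ext (LinearMap.ext fun (a : A) => one_mul (M := A) a)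
  map_mul' b c := ModuleCat.hom_ext (LinearMap.ext fun (a : A) => mul_assoc (G := A) b c a)
  map_zero' := ModuleCat.hom_ext (LinearMap.ext fun (a : A) => zero_mul (M₀ := A) a)
  map_add' b c := ModuleCat.hom_ext (LinearMap.ext fun (a : A) => add_mul (R := A) b c a)

/-- The functor `Hom^𝒞(A, -) : M^𝒞 ⥤ M_B`; the right action of `B` is `(f b)(a) = f(b a)`. -/
noncomputable def homFunctor (hx : 𝒞.IsGrouplike x) :
    Comod 𝒞 ⥤ ModuleCat.{u} (𝒞.coinvariants x)ᵐᵒᵖ :=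
  preadditiveCoyonedaObj (𝒞.base hx) ⋙ ModuleCat.restrictScalars (𝒞.leftMulHom hx).op

/-- The functor `Hom_{*C}(A, -)` from right `*C`-modules to right `B`-modules; the right action
of `B` is `(f b)(a) = f(b a)`. -/
noncomputable def moduleHomFunctor (hx : 𝒞.IsGrouplike x) :
    ModuleCat.{u} 𝒞.Dualᵐᵒᵖ ⥤ ModuleCat.{u} (𝒞.coinvariants x)ᵐᵒᵖ :=
  preadditiveCoyonedaObj (𝒞.base hx).toModule ⋙
    ModuleCat.restrictScalars (𝒞.leftMulModuleHom hx).op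

/-- `A` as a right `B`-module. -/
instance : Module (𝒞.coinvariants x)ᵐᵒᵖ A := Module.compHom A (𝒞.coinvariants x).subtype.op

/-- `β : A ⊗_B A → C`, `a' ⊗ a ↦ a' x a`. -/
noncomputable def galoisMap (x : C) : BalTensor (𝒞.coinvariants x) A A →+ C :=
  BalTensor.lift
    (AddMonoidHom.mk' (fun a' => AddMonoidHom.mk' (fun a => a' • op a • x)
        (fun a b => by rw [MulOpposite.op_add, add_smul, smul_add]))
      (fun a b => by ext c; simp [add_smul]))
    (fun a' b a => by
      have hb : (b : A) • x = op (b : A) • x := b.2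
      change (a' * (b : A)) • op a • x = a' • op ((b : A) * a) • x
      rw [mul_smul, smul_comm (b : A), hb, MulOpposite.op_mul, mul_smul])

/-- The ring extension `A/B` is `𝒞`-Galois: `β` is bijective. -/
def IsGalois (x : C) : Prop := Function.Bijective (𝒞.galoisMap x)

end Coring

namespace Comod

variable {𝒞 : Coring A C}

/-- The coinvariants `M^{co 𝒞} = {m | ϱ(m) = m ⊗ x}` of a comodule. -/
def coinvariants (M : Comod 𝒞) (x : C) : AddSubgroup M where
  carrier := {m | M.coact m = BalTensor.tmul A m x}
  zero_mem' := by simp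
  add_mem' {m n} hm hn := by
    change M.coact (m + n) = _
    change M.coact m = _ at hm
    change M.coact n = _ at hn
    rw [map_add, hm, hn, BalTensor.add_tmul]
  neg_mem' {m} hm := by
    change M.coact (-m) = _
    change M.coact m = _ at hm
    rw [map_neg, hm, BalTensor.neg_tmul]

/-- The coinvariants of the comodule `A` are the elements of `B`. -/
theorem mem_coinvariants_base {x : C} (hx : 𝒞.IsGrouplike x) (a : A) :
    a ∈ (𝒞.base hx).coinvariants x ↔ a ∈ 𝒞.coinvariants x := by
  change BalTensor.tmul A (1 : A) (op a • x) = BalTensor.tmul A a x ↔ a • x = op a • x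
  have h := BalTensor.smul_tmul (M := A) a 1 x
  rw [op_smul_eq_mul, one_mul] at h
  rw [h]
  constructor
  · intro h'
    have h2 := congrArg (BalTensor.contractLeft (LinearMap.id : A →ₗ[Aᵐᵒᵖ] A)) h'
    simpa using h2.symm
  · intro h'
    rw [h']

/-- The coinvariants are a right `B`-module. -/
instance (M : Comod 𝒞) (x : C) : Module (𝒞.coinvariants x)ᵐᵒᵖ (M.coinvariants x) where
  smul b m := ⟨op (b.unop : A) • (m : M), by
    have hm : M.coact (m : M) = BalTensor.tmul A (m : M) x := m.2
    have hb : (b.unop : A) • x = op (b.unop : A) • x := b.unop.2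
    change M.coact _ = BalTensor.tmul A _ x
    rw [map_smul, hm, BalTensor.right_smul_tmul, BalTensor.smul_tmul, hb]⟩
  one_smul m := Subtype.ext (one_smul Aᵐᵒᵖ (m : M))
  mul_smul b c m := Subtype.ext (mul_smul (op (b.unop : A)) (op (c.unop : A)) (m : M))
  smul_zero b := Subtype.ext (smul_zero (op (b.unop : A)))
  smul_add b m n := Subtype.ext (smul_add (op (b.unop : A)) (m : M) (n : M))
  add_smul b c m := Subtype.ext (add_smul (op (b.unop : A)) (op (c.unop : A)) (m : M))
  zero_smul m := Subtype.ext (zero_smul Aᵐᵒᵖ (m : M))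

/-- `Ψ_M : M^{co 𝒞} ⊗_B A → M`, `m ⊗ a ↦ m a`. -/
noncomputable def psi (M : Comod 𝒞) (x : C) :
    BalTensor (𝒞.coinvariants x) (M.coinvariants x) A →+ M :=
  BalTensor.lift
    (AddMonoidHom.mk' (fun m => AddMonoidHom.mk' (fun a => op a • (m : M))
        (fun a b => by rw [MulOpposite.op_add, add_smul]))
      (fun m n => by ext a; simp))
    (fun m b a => (mul_smul (op a) (op (b : A)) (m : M)).symm)

/-- `Ψ'_M : Hom^𝒞(A, M) ⊗_B A → M`, `f ⊗ a ↦ f(a)`. -/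
noncomputable def psi' (M : Comod 𝒞) {x : C} (hx : 𝒞.IsGrouplike x) :
    BalTensor (𝒞.coinvariants x) ((𝒞.homFunctor hx).obj M) A →+ M :=
  BalTensor.lift
    (AddMonoidHom.mk' (fun (f : colinear (𝒞.base hx) M) =>
        AddMonoidHom.mk' (fun a : A => f.1 a) f.1.map_add)
      (fun f g => by ext a; rfl))
    (fun f b a => rfl)

end Comod

/-- The weak structure theorem for `M^𝒞`: `Ψ_M` is bijective for every comodule `M`. -/
def Coring.WeakStructureTheorem (𝒞 : Coring A C) (x : C) : Prop :=
  ∀ M : Comod 𝒞, Function.Bijective (M.psi x)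

end Comodules

/-! Condition 6, `σ[C] = Gen(A)`, is the hub of the proof. Local projectivity supplies finite dual
bases on finitely generated submodules of `C`, and hence the α-condition
(`LocallyProjective.ext_contractRight`): an element of `M ⊗_A C` is determined by its contractions
with functionals on `C`. Therefore `*C`-linear maps between comodules are colinear
(`Comod.homOfLinear`), and the modules underlying comodules are, up to isomorphism, exactly those in
`σ[C]` (`exists_equiv_of_subgen`, `Comod.subgen_regular`). In particular the `*C`-endomorphisms of
`A` are the left multiplications by `B`, and `Ψ'_M` becomes the evaluation map `Hom_{*C}(A, X) ⊗_B A
→ X`. The image of that map is the trace of `A` in `X`, so it is onto exactly when `X` is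
`A`-generated. Coinvariants of `M` are the values at `1` of colinear maps `A → M`, which matches `Ψ`
with `Ψ'` and, for `M = C`, with the Galois map.

Out of 6: all submodules of direct sums of copies of `A` are `A`-generated. A homomorphism from `A`
into such a submodule is multiplication by a finite vector over `B`, so every solution in `A` of a
linear system over `B` is a sum of products of a solution over `B` with an element of `A`
(`mem_closure_smulConst`). This is the equational criterion for flatness of `A` over `B`
(`leftFlat_of_gen`). Applied to the kernel of `A^(Hom(A, X)) → X`, the same decomposition makes
evaluation injective (`evalMap_injective_of_gen`).

Back to 6: if `A` is a generator, the quotient of a comodule by the trace of `A` is again a comodule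
that no map from `A` detects, so it is zero (`gen_of_isSeparator`). If `A` is flat and evaluation is
bijective on `Gen(A)`, a diagram chase shows that `Gen(A)` is closed under submodules
(`gen_of_subgen`); fullness of `Hom(A, -)` yields the injectivity needed there
(`evalMap_injective_of_full`). If `A` is flat and `A/B` is Galois, then `M ⊗_B A ≅ M ⊗_A C`, and
flatness exhibits the coaction of each `m` as coming from `M^{co C} ⊗_B A`
(`psi_surjective_of_isGalois`); surjectivity of all `Ψ'_M` makes `A` a generator. -/

namespace BalTensor

/-! ### Tensor products: right exactness and vanishing of tensors -/

section General

variable {R : Type*} [Ring R] {M : Type*} [AddCommGroup M] [Module Rᵐᵒᵖ M]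
  {N : Type*} [AddCommGroup N] [Module R N]
  {M' : Type*} [AddCommGroup M'] [Module Rᵐᵒᵖ M']
  {N' : Type*} [AddCommGroup N'] [Module R N']
  {P : Type*} [AddCommGroup P]

variable (R) in
/-- `n ↦ m ⊗ n` as an additive map. -/
noncomputable def tmulHom (m : M) : N →+ BalTensor R M N :=
  AddMonoidHom.mk' (tmul R m) (tmul_add m)

@[simp]
theorem tmulHom_apply (m : M) (n : N) : tmulHom R m n = tmul R m n := rfl

variable (R M N) in
/-- The map `s ↦ ∑ m ⊗ s(m)` on finitely supported functions. -/
noncomputable def sumTmul : (M →₀ N) →+ BalTensor R M N :=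
  Finsupp.liftAddHom (tmulHom R)

@[simp]
theorem sumTmul_single (m : M) (n : N) : sumTmul R M N (Finsupp.single m n) = tmul R m n := by
  simp [sumTmul]

theorem sumTmul_surjective : Function.Surjective (sumTmul R M N) := by
  intro t
  induction t using induction_on with
  | zero => exact ⟨0, map_zero _⟩
  | tmul m n => exact ⟨_, sumTmul_single m n⟩
  | add s t hs ht =>
    obtain ⟨a, rfl⟩ := hs
    obtain ⟨b, rfl⟩ := ht
    exact ⟨a + b, map_add _ _ _⟩

theorem map_bijective (e : M ≃ₗ[Rᵐᵒᵖ] M') :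
    Function.Bijective (map e.toLinearMap (LinearMap.id : N →ₗ[R] N)) := by
  have h1 : (map e.symm.toLinearMap (LinearMap.id : N →ₗ[R] N)).comp
      (map e.toLinearMap (LinearMap.id : N →ₗ[R] N)) = AddMonoidHom.id _ :=
    hom_ext fun m n => by simp
  have h2 : (map e.toLinearMap (LinearMap.id : N →ₗ[R] N)).comp
      (map e.symm.toLinearMap (LinearMap.id : N →ₗ[R] N)) = AddMonoidHom.id _ :=
    hom_ext fun m n => by simp
  exact Function.bijective_iff_has_inverse.2
    ⟨_, fun t => DFunLike.congr_fun h1 t, fun t => DFunLike.congr_fun h2 t⟩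

theorem sumTmul_mapDomain (f : M →ₗ[Rᵐᵒᵖ] M') (s : M →₀ N) :
    sumTmul R M' N (s.mapDomain f) = map f LinearMap.id (sumTmul R M N s) := by
  induction s using Finsupp.induction_linear with
  | zero => simp
  | add s t hs ht => simp [Finsupp.mapDomain_add, hs, ht]
  | single m n => simp [Finsupp.mapDomain_single]

/-- Lets coassociativity be verified in `(X ⊗ C) ⊗ C`, where contraction with the last factor is
available, without constructing the inverse of `assoc`. -/
theorem assoc_surjective {S : Type*} [Ring S] [Module Sᵐᵒᵖ N] [SMulCommClass R Sᵐᵒᵖ N]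
    [Module S P] :
    Function.Surjective
      (assoc : BalTensor S (BalTensor R M N) P →+ BalTensor R M (BalTensor S N P)) := by
  rw [← AddMonoidHom.range_eq_top, eq_top_iff]
  rintro t -
  induction t using induction_on with
  | zero => exact zero_mem _
  | add s t hs ht => exact add_mem hs ht
  | tmul m t =>
    induction t using induction_on with
    | zero => rw [tmul_zero]; exact zero_mem _
    | add s t hs ht => rw [tmul_add]; exact add_mem hs ht
    | tmul n p => exact ⟨tmul S (tmul R m n) p, rfl⟩

/-- Right exactness: the kernel of `g ⊗ N` is the image of `f ⊗ N` if `g` is surjective with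
kernel the image of `f`. -/
theorem exists_map_eq_of_exact {M'' : Type*} [AddCommGroup M''] [Module Rᵐᵒᵖ M'']
    (f : M →ₗ[Rᵐᵒᵖ] M') (g : M' →ₗ[Rᵐᵒᵖ] M'') (hg : Function.Surjective g)
    (hfg : ∀ y, g y = 0 → ∃ x, f x = y) (t : BalTensor R M' N)
    (ht : map g (LinearMap.id : N →ₗ[R] N) t = 0) :
    ∃ s, map f (LinearMap.id : N →ₗ[R] N) s = t := by
  let I := (map f (LinearMap.id : N →ₗ[R] N)).range
  let q := QuotientAddGroup.mk' I
  -- Modulo the image of `f ⊗ N`, the class of `y ⊗ n` depends only on `g y`. Arbitrary preimages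
  -- under `g` thus define a balanced map out of `M'' ⊗ N` that retracts `g ⊗ N` onto the cokernel
  -- of `f ⊗ N`.
  have key : ∀ (y y' : M') (n : N), g y = g y' → q (tmul R y n) = q (tmul R y' n) := by
    intro y y' n h
    obtain ⟨x, hx⟩ := hfg (y - y') (by rw [map_sub, h, sub_self])
    have h2 : tmul R y n = tmul R y' n + tmul R (y - y') n := by
      rw [← add_tmul, add_sub_cancel]
    rw [h2, map_add, add_eq_left]
    exact (QuotientAddGroup.eq_zero_iff _).2 ⟨tmul R x n, by simp [hx]⟩
  have hs : ∀ z, g (Function.surjInv hg z) = z := Function.surjInv_eq hg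
  let h : BalTensor R M'' N →+ BalTensor R M' N ⧸ I :=
    lift (AddMonoidHom.mk' (fun z => q.comp (tmulHom R (Function.surjInv hg z)))
      (fun z z' => by
        ext n
        change q (tmul R _ n) = q (tmul R _ n) + q (tmul R _ n)
        rw [← map_add, ← add_tmul]
        exact key _ _ _ (by simp [hs])))
    (fun z r n => by
      change q (tmul R _ n) = q (tmul R _ (r • n))
      rw [← smul_tmul]
      exact key _ _ _ (by simp [hs]))
  have hh : h.comp (map g (LinearMap.id : N →ₗ[R] N)) = q :=
    hom_ext fun y n => key _ _ _ (by simp [hs])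
  have h0 : q t = 0 := by
    rw [← hh, AddMonoidHom.comp_apply, ht, map_zero]
  exact (QuotientAddGroup.eq_zero_iff _).1 h0

variable (R M) in
/-- The map `b ↦ ∑ m b(m)`. -/
noncomputable def rsum : (M →₀ R) →+ M :=
  Finsupp.liftAddHom fun m => AddMonoidHom.mk' (fun r => op r • m) fun r s => by
    rw [MulOpposite.op_add, add_smul]

@[simp]
theorem rsum_single (m : M) (r : R) : rsum R M (Finsupp.single m r) = op r • m := by
  simp [rsum]

theorem rsum_mapDomain (f : M →ₗ[Rᵐᵒᵖ] M') (b : M →₀ R) :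
    rsum R M' (b.mapDomain f) = f (rsum R M b) := by
  induction b using Finsupp.induction_linear with
  | zero => simp
  | add s t hs ht => simp [Finsupp.mapDomain_add, hs, ht]
  | single m n => simp [Finsupp.mapDomain_single]

/-- The pointwise product `b n` of a finitely supported function `b` and an element `n`. -/
noncomputable def _root_.Finsupp.smulConst {J : Type*} (b : J →₀ R) (n : N) : J →₀ N :=
  b.mapRange (fun r => r • n) (zero_smul R n)

@[simp]
theorem _root_.Finsupp.smulConst_apply {J : Type*} (b : J →₀ R) (n : N) (j : J) :
    b.smulConst n j = b j • n := rfl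

/-- Used when `b` is a relation, that is `rsum R M b = 0`: the tensor built from `b` and `n` then
vanishes. -/
theorem sumTmul_smulConst (b : M →₀ R) (n : N) :
    sumTmul R M N (b.smulConst n) = tmul R (rsum R M b) n := by
  induction b using Finsupp.induction_linear with
  | zero =>
    have h : (0 : M →₀ R).smulConst n = 0 := by ext; simp
    simp [h]
  | add s t hs ht =>
    have h : (s + t).smulConst n = s.smulConst n + t.smulConst n := by ext; simp [add_smul]
    rw [h, map_add, map_add, hs, ht, add_tmul]
  | single m r =>
    have h : (Finsupp.single m r).smulConst n = Finsupp.single m (r • n) := by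
      simp [Finsupp.smulConst]
    rw [h, sumTmul_single, rsum_single, smul_tmul]

variable (M N) in
/-- The map `n ↦ ∑ j n(j)`, summing over the relations `j` of `M`. -/
noncomputable def relComb : ((rsum R M).ker →₀ N) →+ (M →₀ N) :=
  Finsupp.liftAddHom fun j => AddMonoidHom.mk' (fun n => j.1.smulConst n) fun n n' => by
    ext; simp

theorem relComb_single (j : (rsum R M).ker) (n : N) :
    relComb M N (Finsupp.single j n) = j.1.smulConst n := by
  exact Finsupp.liftAddHom_apply_single _ _ _

theorem relComb_apply (n : (rsum R M).ker →₀ N) (m : M) :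
    relComb M N n m = n.sum fun j x => j.1 m • x := by
  rw [relComb, Finsupp.liftAddHom_apply, Finsupp.sum_apply]
  rfl

theorem rsum_smulConst (b : M →₀ R) (r : R) :
    rsum R M (b.smulConst r) = op r • rsum R M b := by
  induction b using Finsupp.induction_linear with
  | zero =>
    have h : (0 : M →₀ R).smulConst r = 0 := by ext; simp
    simp [h]
  | add s t hs ht =>
    have h : (s + t).smulConst r = s.smulConst r + t.smulConst r := by ext; simp [add_mul]
    rw [h, map_add, map_add, hs, ht, smul_add]
  | single m x =>
    have h : (Finsupp.single m x).smulConst r = Finsupp.single m (x * r) := by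
      simp [Finsupp.smulConst]
    rw [h, rsum_single, rsum_single, op_mul, mul_smul]

theorem rsum_relComb (d : (rsum R M).ker →₀ R) : rsum R M (relComb M R d) = 0 := by
  induction d using Finsupp.induction_linear with
  | zero => simp
  | add s t hs ht => rw [map_add, map_add, hs, ht, add_zero]
  | single j r => rw [relComb_single, rsum_smulConst, j.2, smul_zero]

/-- A sum `∑ m ⊗ s(m)` vanishes only if `s` is a combination of relations. -/
theorem exists_relComb_eq (s : M →₀ N) (hs : sumTmul R M N s = 0) :
    ∃ n, relComb (R := R) M N n = s := by
  let I := (relComb (R := R) M N).range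
  let q := QuotientAddGroup.mk' I
  have key : ∀ (b : M →₀ R) (n : N), rsum R M b = 0 → q (b.smulConst n) = 0 := fun b n hb =>
    (QuotientAddGroup.eq_zero_iff _).2 ⟨Finsupp.single ⟨b, hb⟩ n, relComb_single _ _⟩
  -- Additivity and balancedness of `m ⊗ n ↦ [single m n]` hold because the defining relations of
  -- the tensor product are themselves relations of `M`, multiplied by `n`.
  let h : BalTensor R M N →+ (M →₀ N) ⧸ I :=
    lift (AddMonoidHom.mk' (fun m => q.comp (Finsupp.singleAddHom m)) (fun m m' => by
      ext n
      change q (Finsupp.single _ n) = q (Finsupp.single _ n) + q (Finsupp.single _ n)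
      rw [← map_add, ← sub_eq_zero, ← map_sub]
      convert key (Finsupp.single (m + m') 1 - (Finsupp.single m 1 + Finsupp.single m' 1)) n
        (by simp) using 2
      ext i
      classical simp [Finsupp.single_apply, sub_smul, add_smul, ite_smul]))
    (fun m r n => by
      change q (Finsupp.single _ n) = q (Finsupp.single _ (r • n))
      rw [← sub_eq_zero, ← map_sub]
      convert key (Finsupp.single (op r • m) 1 - Finsupp.single m r) n
        (by simp) using 2
      ext i
      classical simp [Finsupp.single_apply, sub_smul, ite_smul])
  have hh : h.comp (sumTmul R M N) = q := Finsupp.addHom_ext fun m n => by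
    rw [AddMonoidHom.comp_apply, sumTmul_single]
    rfl
  have h0 : q s = 0 := by rw [← hh, AddMonoidHom.comp_apply, hs, map_zero]
  exact (QuotientAddGroup.eq_zero_iff _).1 h0

end General

end BalTensor

/-! ### Flatness over a noncommutative ring -/

section Flat

variable {R : Type u} [Ring R] {N : Type u} [AddCommGroup N] [Module R N]

/-- The equational criterion of flatness, for arbitrary systems of relations. -/
theorem leftFlat_of_equational
    (H : ∀ (J : Type u) (rel : Set (J → R)) (n : J →₀ N),
      (∀ ρ ∈ rel, (n.sum fun j x => ρ j • x) = 0) →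
      n ∈ AddSubgroup.closure {s | ∃ (d : J →₀ R) (p : N),
        (∀ ρ ∈ rel, (d.sum fun j x => ρ j * x) = 0) ∧ s = d.smulConst p}) :
    LeftFlat R N := by
  intro X Y _ _ _ _ f hf
  rw [injective_iff_map_eq_zero]
  intro t ht
  obtain ⟨s, rfl⟩ := BalTensor.sumTmul_surjective t
  rw [← BalTensor.sumTmul_mapDomain] at ht
  obtain ⟨n, hn⟩ := BalTensor.exists_relComb_eq _ ht
  -- A combination of relations of `Y` is restricted along `f` to a function on `X` and then turned
  -- into a tensor. The given `n` maps to the tensor that has to vanish.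
  let Θ : ((BalTensor.rsum R Y).ker →₀ N) →+ BalTensor R X N :=
    ((BalTensor.sumTmul R X N).comp (Finsupp.comapDomain.addMonoidHom hf)).comp
      (BalTensor.relComb Y N)
  have hΘ : Θ n = BalTensor.sumTmul R X N s := by
    change BalTensor.sumTmul R X N (Finsupp.comapDomain f (BalTensor.relComb Y N n) _) = _
    congr 1
    ext x
    rw [Finsupp.comapDomain_apply, hn, Finsupp.mapDomain_apply hf]
  rw [← hΘ]
  -- One equation for each `y` outside the range of `f`: the combined relation must have coefficient
  -- zero at `y`. There may be infinitely many such equations, hence the arbitrary systems in `H`.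
  let rel : Set ((BalTensor.rsum R Y).ker → R) := {ρ | ∃ y ∉ Set.range f, ρ = fun j => j.1 y}
  have hmem := H _ rel n (by
    rintro _ ⟨y, hy, rfl⟩
    rw [← BalTensor.relComb_apply, hn, Finsupp.mapDomain_of_notMem_range _ _ hy])
  suffices h : AddSubgroup.closure _ ≤ Θ.ker from h hmem
  rw [AddSubgroup.closure_le]
  rintro _ ⟨d, p, hd, rfl⟩
  let e : Y →₀ R := BalTensor.relComb Y R d
  have he : ∀ y ∉ Set.range f, e y = 0 := fun y hy =>
    (BalTensor.relComb_apply d y).trans (hd _ ⟨y, hy, rfl⟩)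
  have hcomp : BalTensor.relComb Y N (d.smulConst p) = e.smulConst p := by
    ext y
    rw [BalTensor.relComb_apply, Finsupp.smulConst_apply, BalTensor.relComb_apply,
      Finsupp.sum, Finsupp.sum, Finset.sum_smul]
    refine (Finset.sum_subset (Finsupp.support_mapRange) fun j _ hj => ?_).trans
      (Finset.sum_congr rfl fun j _ => ?_)
    · have h0 : d.smulConst p j = 0 := Finsupp.notMem_support_iff.1 hj
      rw [h0, smul_zero]
    · simp [mul_smul]
  have hsum : BalTensor.rsum R Y e = 0 := BalTensor.rsum_relComb d
  change BalTensor.sumTmul R X N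
    (Finsupp.comapDomain f (BalTensor.relComb Y N (d.smulConst p)) hf.injOn) = 0
  have h1 : Finsupp.comapDomain f (BalTensor.relComb Y N (d.smulConst p)) hf.injOn =
      (Finsupp.comapDomain f e hf.injOn).smulConst p := by
    rw [hcomp]
    ext x
    simp
  -- The relation `e` of `Y` is supported on the range of the injective map `f`, so it pulls back to
  -- a relation of `X`.
  have h2 : BalTensor.rsum R X (Finsupp.comapDomain f e hf.injOn) = 0 := by
    apply hf
    rw [← BalTensor.rsum_mapDomain, map_zero, Finsupp.mapDomain_comapDomain f hf, hsum]
    intro y hy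
    by_contra h
    exact Finsupp.mem_support_iff.1 hy (he y h)
  rw [h1, BalTensor.sumTmul_smulConst, h2, BalTensor.zero_tmul]

/-- Flat tensor products preserve exactness in the middle. -/
theorem LeftFlat.exists_map_eq_of_exact (hN : LeftFlat R N) {X Y Z : Type u} [AddCommGroup X]
    [Module Rᵐᵒᵖ X] [AddCommGroup Y] [Module Rᵐᵒᵖ Y] [AddCommGroup Z] [Module Rᵐᵒᵖ Z]
    (f : X →ₗ[Rᵐᵒᵖ] Y) (g : Y →ₗ[Rᵐᵒᵖ] Z) (hfg : ∀ y, g y = 0 → ∃ x, f x = y)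
    (t : BalTensor R Y N) (ht : BalTensor.map g (LinearMap.id : N →ₗ[R] N) t = 0) :
    ∃ s, BalTensor.map f (LinearMap.id : N →ₗ[R] N) s = t := by
  -- Factor `g` through its range: the surjective part is handled by right exactness, and the
  -- inclusion of the range stays injective after tensoring, by flatness.
  refine BalTensor.exists_map_eq_of_exact f g.rangeRestrict g.surjective_rangeRestrict
    (fun y hy => hfg y (congrArg Subtype.val hy)) t ?_
  apply hN _ _ g.range.subtype g.range.injective_subtype
  rw [map_zero, ← ht]
  have h : (BalTensor.map g.range.subtype LinearMap.id).comp
      (BalTensor.map g.rangeRestrict (LinearMap.id : N →ₗ[R] N)) =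
      BalTensor.map g LinearMap.id := BalTensor.hom_ext fun m n => by simp
  exact DFunLike.congr_fun h t

end Flat

/-! ### Closure properties of `Gen(W)` and `σ[W]` -/

section GenSigma

variable {R : Type u} [Ring R] {W : ModuleCat.{u} R}

/-- Any generating family may be enlarged to the family of all homomorphisms `W → X`, so being
generated becomes an elementwise condition with a canonical index set. -/
theorem gen_iff_exists_finsupp {X : ModuleCat.{u} R} :
    Gen W X ↔ ∀ x : X, ∃ s : (W →ₗ[R] X) →₀ W, Finsupp.lsum ℕ (fun f => f) s = x := by
  constructor
  · rintro ⟨Λ, p, hp⟩ x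
    obtain ⟨s, rfl⟩ := hp x
    refine ⟨s.mapDomain fun l => p.comp (Finsupp.lsingle l), ?_⟩
    induction s using Finsupp.induction_linear with
    | zero => simp
    | add s t hs ht => rw [Finsupp.mapDomain_add, map_add, hs, ht, map_add]
    | single l w => simp [Finsupp.mapDomain_single]
  · intro h
    exact ⟨W →ₗ[R] X, Finsupp.lsum ℕ fun f => f, h⟩

theorem Gen.of_surjective {X Y : ModuleCat.{u} R} (hX : Gen W X) (g : X →ₗ[R] Y)
    (hg : Function.Surjective g) : Gen W Y := by
  obtain ⟨Λ, p, hp⟩ := hX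
  exact ⟨Λ, g.comp p, hg.comp hp⟩

theorem Gen.finsupp {X : ModuleCat.{u} R} (hX : Gen W X) (J : Type u) :
    Gen W (ModuleCat.of R (J →₀ X)) := by
  rw [gen_iff_exists_finsupp] at hX ⊢
  intro (x : J →₀ X)
  induction x using Finsupp.induction_linear with
  | zero => exact ⟨0, map_zero _⟩
  | add x y hx hy =>
    obtain ⟨s, rfl⟩ := hx
    obtain ⟨t, rfl⟩ := hy
    exact ⟨s + t, map_add _ _ _⟩
  | single j x =>
    obtain ⟨s, rfl⟩ := hX x
    refine ⟨s.mapDomain fun f => (Finsupp.lsingle j).comp f, ?_⟩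
    induction s using Finsupp.induction_linear with
    | zero => simp
    | add s t hs ht => rw [Finsupp.mapDomain_add, map_add, hs, ht, map_add, Finsupp.single_add]
    | single l w => simp [Finsupp.mapDomain_single]

theorem Gen.subgen {X : ModuleCat.{u} R} (hX : Gen W X) : Subgen W X :=
  ⟨X, LinearMap.id, hX, Function.injective_id⟩

theorem Subgen.of_injective {X Y : ModuleCat.{u} R} (hY : Subgen W Y) (i : X →ₗ[R] Y)
    (hi : Function.Injective i) : Subgen W X := by
  obtain ⟨Z, j, hZ, hj⟩ := hY
  exact ⟨Z, j.comp i, hZ, hj.comp hi⟩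

/-- If `X` embeds in a generated module `Z`, then `X / ker g` embeds in `Z / j(ker g)`, which is
still generated. -/
theorem Subgen.of_surjective {X Y : ModuleCat.{u} R} (hX : Subgen W X) (g : X →ₗ[R] Y)
    (hg : Function.Surjective g) : Subgen W Y := by
  obtain ⟨Z, j, hZ, hj⟩ := hX
  let K := (LinearMap.ker g).map j
  have hK : ∀ x, j x ∈ K → g x = 0 := by
    rintro x ⟨y, hy, hxy⟩
    rwa [← hj hxy]
  let e := g.quotKerEquivOfSurjective hg
  let i : (X ⧸ LinearMap.ker g) →ₗ[R] Z ⧸ K :=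
    (LinearMap.ker g).mapQ K j (Submodule.le_comap_map _ _)
  refine ⟨ModuleCat.of R (Z ⧸ K), i.comp e.symm.toLinearMap,
    hZ.of_surjective K.mkQ K.mkQ_surjective, ?_⟩
  refine Function.Injective.comp (g := i) (f := e.symm) ?_ e.symm.injective
  rw [injective_iff_map_eq_zero]
  intro x hx
  obtain ⟨x, rfl⟩ := (LinearMap.ker g).mkQ_surjective x
  exact (Submodule.Quotient.mk_eq_zero _).2 (hK x ((Submodule.Quotient.mk_eq_zero _).1 hx))

theorem Subgen.finsupp {X : ModuleCat.{u} R} (hX : Subgen W X) (J : Type u) :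
    Subgen W (ModuleCat.of R (J →₀ X)) := by
  obtain ⟨Z, j, hZ, hj⟩ := hX
  refine ⟨ModuleCat.of R (J →₀ Z), Finsupp.mapRange.linearMap j, hZ.finsupp J, ?_⟩
  exact Finsupp.mapRange_injective _ (map_zero j) hj

theorem Subgen.of_gen {V X : ModuleCat.{u} R} (hX : Gen V X) (hV : Subgen W V) : Subgen W X := by
  obtain ⟨Λ, p, hp⟩ := hX
  exact (hV.finsupp Λ).of_surjective (Y := X) p hp

end GenSigma

/-! ### Dual bases and the α-condition -/

section LocallyProjective

variable {A : Type u} [Ring A] {C : Type u} [AddCommGroup C] [Module A C]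
  {M : Type*} [AddCommGroup M] [Module Aᵐᵒᵖ M] {M' : Type*} [AddCommGroup M'] [Module Aᵐᵒᵖ M']

/-- Finitely generated submodules of a locally projective module have finite dual bases. -/
theorem LocallyProjective.exists_dualBasis (hC : LocallyProjective A C) (F : Submodule A C)
    (hF : F.FG) :
    ∃ (s : Finset C) (φ : C → C →ₗ[A] A), ∀ w ∈ F, ∑ c ∈ s, φ c w • c = w := by
  classical
  -- Lift the identity of `C` on `F` along the canonical free cover of `C`. The coordinates of the
  -- lift are the dual functionals, and only finitely many of them are nonzero on the generators of
  -- `F`.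
  obtain ⟨g, hg⟩ := hC F hF (C →₀ A) C (Finsupp.linearCombination A id) LinearMap.id
    (Finsupp.linearCombination_id_surjective A C)
  obtain ⟨t, rfl⟩ := hF
  let s := t.biUnion fun w => (g w).support
  have hs : ∀ w ∈ Submodule.span A (t : Set C), g w ∈ Finsupp.supported A A (s : Set C) := by
    suffices h : Submodule.span A (t : Set C) ≤ (Finsupp.supported A A (s : Set C)).comap g from
      fun w hw => h hw
    rw [Submodule.span_le]
    intro w hw c hc
    exact Finset.mem_coe.2 (Finset.mem_biUnion.2 ⟨w, hw, hc⟩)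
  refine ⟨s, fun c => (Finsupp.lapply c).comp g, fun w hw => ?_⟩
  refine Eq.trans ?_ (hg w hw)
  rw [Finsupp.linearCombination_apply,
    Finsupp.sum_of_support_subset _ (Finset.coe_subset.1 (hs w hw)) _ (by simp)]
  rfl

theorem BalTensor.contractRight_map (f : C →ₗ[A] A) (g : M →ₗ[Aᵐᵒᵖ] M') (t : BalTensor A M C) :
    contractRight f (map g LinearMap.id t) = g (contractRight f t) := by
  induction t using BalTensor.induction_on with
  | zero => simp
  | tmul m c => simp
  | add s t hs ht => simp [hs, ht]

/-- The right-hand factors of a representation of `t` span a finitely generated submodule. Expanding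
them in a dual basis and moving the coefficients across the tensor sign recovers `t` from its
contractions. -/
theorem LocallyProjective.exists_eq_sum_contractRight (hC : LocallyProjective A C)
    (t : BalTensor A M C) : ∃ (s : Finset C) (φ : C → C →ₗ[A] A),
      ∑ c ∈ s, BalTensor.tmul A (BalTensor.contractRight (φ c) t) c = t := by
  -- Quantifying over every dual basis of `F` makes the claim additive in `t`: for a sum, use `F ⊔
  -- G`, whose dual bases serve both summands.
  suffices h : ∃ F : Submodule A C, F.FG ∧ ∀ (s : Finset C) (φ : C → C →ₗ[A] A),
      (∀ w ∈ F, ∑ c ∈ s, φ c w • c = w) →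
      ∑ c ∈ s, BalTensor.tmul A (BalTensor.contractRight (φ c) t) c = t by
    obtain ⟨F, hF, h⟩ := h
    obtain ⟨s, φ, hs⟩ := hC.exists_dualBasis F hF
    exact ⟨s, φ, h s φ hs⟩
  induction t using BalTensor.induction_on with
  | zero => exact ⟨⊥, Submodule.fg_bot, fun s φ _ => by simp⟩
  | tmul m c =>
    refine ⟨Submodule.span A {c}, Submodule.fg_span_singleton c, fun s φ h => ?_⟩
    simp_rw [BalTensor.contractRight_tmul, BalTensor.smul_tmul, ← BalTensor.tmulHom_apply,
      ← map_sum]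
    rw [h c (Submodule.mem_span_singleton_self c)]
  | add a b ha hb =>
    obtain ⟨F, hF, hFa⟩ := ha
    obtain ⟨G, hG, hGb⟩ := hb
    refine ⟨F ⊔ G, hF.sup hG, fun s φ h => ?_⟩
    simp_rw [map_add, BalTensor.add_tmul, Finset.sum_add_distrib]
    rw [hFa s φ fun w hw => h w (Submodule.mem_sup_left hw),
      hGb s φ fun w hw => h w (Submodule.mem_sup_right hw)]

/-- The `α`-condition: elements of `M ⊗ C` are separated by the functionals on `C`. -/
theorem LocallyProjective.ext_contractRight (hC : LocallyProjective A C) {t t' : BalTensor A M C}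
    (h : ∀ f : C →ₗ[A] A, BalTensor.contractRight f t = BalTensor.contractRight f t') : t = t' := by
  rw [← sub_eq_zero]
  obtain ⟨s, φ, hs⟩ := hC.exists_eq_sum_contractRight (t - t')
  rw [← hs]
  exact Finset.sum_eq_zero fun c _ => by rw [map_sub, h, sub_self, BalTensor.zero_tmul]

end LocallyProjective

/-! ### The map `A → *C`; linear maps of comodules are colinear -/

section Comodules

variable {A : Type u} [Ring A] {C : Type u} [AddCommGroup C] [Module A C]
  [Module Aᵐᵒᵖ C] [SMulCommClass A Aᵐᵒᵖ C] {𝒞 : Coring A C}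

theorem LocallyProjective.ext_dual (hC : LocallyProjective A C) {M : Type*} [AddCommGroup M]
    [Module Aᵐᵒᵖ M] {t t' : BalTensor A M C} (h : ∀ f : 𝒞.Dual,
      BalTensor.contractRight f.toLin t = BalTensor.contractRight f.toLin t') : t = t' :=
  hC.ext_contractRight fun f => h f

namespace Coring.Dual

variable (𝒞) in
/-- A left linear map `C → A` as an element of the dual ring. -/
def ofLin (f : C →ₗ[A] A) : 𝒞.Dual := f

variable (𝒞) in
/-- The ring homomorphism `A → *C`, `a ↦ ε(-) a`. -/
noncomputable def ofScalar : A →+* 𝒞.Dual where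
  toFun a := (𝒞.counit.smulRight a : C →ₗ[A] A)
  map_one' := LinearMap.ext fun c => mul_one (𝒞.counit c)
  map_zero' := LinearMap.ext fun c => mul_zero (𝒞.counit c)
  map_add' a b := LinearMap.ext fun c => mul_add (𝒞.counit c) a b
  map_mul' a b := LinearMap.ext fun c => by
    change 𝒞.counit c * (a * b) =
      𝒞.counit (BalTensor.contractRight (𝒞.counit.smulRight a) (𝒞.comul c)) * b
    have h : BalTensor.contractRight (𝒞.counit.smulRight a) (𝒞.comul c) = op a • c := by
      conv_rhs => rw [← 𝒞.counit_right c]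
      generalize 𝒞.comul c = t
      induction t using BalTensor.induction_on with
      | zero => simp
      | tmul m c => simp [mul_smul]
      | add s t hs ht => simp [hs, ht]
    rw [h, 𝒞.counit_op_smul, ← mul_assoc]
    rfl

theorem ofScalar_apply (a : A) (c : C) : (ofScalar 𝒞 a).toLin c = 𝒞.counit c * a := rfl

/-- By the right counit law, `ε(-) a` acts on `C` as right multiplication by `a`. -/
theorem ofScalar_mul_apply (a : A) (f : 𝒞.Dual) (c : C) :
    (ofScalar 𝒞 a * f).toLin c = f.toLin (op a • c) := by
  change f.toLin (BalTensor.contractRight (𝒞.counit.smulRight a) (𝒞.comul c)) = _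
  congr 1
  conv_rhs => rw [← 𝒞.counit_right c]
  generalize 𝒞.comul c = t
  induction t using BalTensor.induction_on with
  | zero => simp
  | tmul m c => simp [mul_smul]
  | add s t hs ht => simp [hs, ht]

end Coring.Dual

namespace Comod

open Coring.Dual

theorem dual_smul_def (M : Comod 𝒞) (f : 𝒞.Dual) (m : M) :
    op f • m = BalTensor.contractRight f.toLin (M.coact m) := rfl

theorem ofScalar_smul (M : Comod 𝒞) (a : A) (m : M) : op (ofScalar 𝒞 a) • m = op a • m := by
  rw [dual_smul_def]
  conv_rhs => rw [← M.counit m]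
  generalize M.coact m = t
  induction t using BalTensor.induction_on with
  | zero => simp
  | tmul m c => simp [ofScalar_apply, mul_smul]
  | add s t hs ht => simp [hs, ht]

/-- Over a locally projective coring, `*C`-linear maps of comodules are colinear. -/
noncomputable def homOfLinear (hC : LocallyProjective A C) {M N : Comod 𝒞}
    (g : M.toModule →ₗ[𝒞.Dualᵐᵒᵖ] N.toModule) : M ⟶ N :=
  ⟨{  toFun := g
      map_add' := g.map_add
      map_smul' := fun a m => by
        have h1 := ofScalar_smul M a.unop m
        have h2 := ofScalar_smul N a.unop (g m)
        exact ((congrArg g h1.symm).trans (g.map_smul _ _)).trans h2 },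
    -- Contracted with `f`, the colinearity equation says that `g` commutes with the action of `f`.
    fun m => hC.ext_dual fun f => by
      rw [BalTensor.contractRight_map]
      exact (g.map_smul (op f) m).symm⟩

end Comod

/-! ### Rational modules: comodules as the modules in `σ[C]` -/

section Rational

open Coring.Dual

variable (𝒞) in
/-- The pairing `(f, y) ↦ ∑ y(c) f(c)` of the dual with a right `*C`-module. -/
noncomputable def rationalPairing (X : Type u) [AddCommGroup X] [Module 𝒞.Dualᵐᵒᵖ X] (f : 𝒞.Dual) :
    (C →₀ X) →+ X :=
  Finsupp.liftAddHom fun c => DistribSMul.toAddMonoidHom X (op (ofScalar 𝒞 (f.toLin c)))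

@[simp]
theorem rationalPairing_single (X : Type u) [AddCommGroup X] [Module 𝒞.Dualᵐᵒᵖ X] (f : 𝒞.Dual)
    (c : C) (x : X) :
    rationalPairing 𝒞 X f (Finsupp.single c x) = op (ofScalar 𝒞 (f.toLin c)) • x :=
  Finsupp.liftAddHom_apply_single _ _ _

variable (𝒞) in
/-- The rational `*C`-modules: the action on each element comes from an element of `X ⊗ C`. -/
def IsRational (X : Type u) [AddCommGroup X] [Module 𝒞.Dualᵐᵒᵖ X] : Prop :=
  ∀ x : X, ∃ y : C →₀ X, ∀ f : 𝒞.Dual, op f • x = rationalPairing 𝒞 X f y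

variable {X : Type u} [AddCommGroup X] [Module 𝒞.Dualᵐᵒᵖ X]
  {Y : Type u} [AddCommGroup Y] [Module 𝒞.Dualᵐᵒᵖ Y]

theorem rationalPairing_mapRange (g : X →ₗ[𝒞.Dualᵐᵒᵖ] Y) (f : 𝒞.Dual) (y : C →₀ X) :
    rationalPairing 𝒞 Y f (y.mapRange g g.map_zero) = g (rationalPairing 𝒞 X f y) := by
  induction y using Finsupp.induction_linear with
  | zero => simp
  | add s t hs ht => rw [Finsupp.mapRange_add (map_add g), map_add, hs, ht, map_add, map_add]
  | single c x => simp

theorem IsRational.of_surjective (hX : IsRational 𝒞 X) (g : X →ₗ[𝒞.Dualᵐᵒᵖ] Y)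
    (hg : Function.Surjective g) : IsRational 𝒞 Y := by
  intro y
  obtain ⟨x, rfl⟩ := hg y
  obtain ⟨t, ht⟩ := hX x
  exact ⟨t.mapRange g g.map_zero, fun f => by
    rw [rationalPairing_mapRange, ← ht, map_smul]⟩

theorem IsRational.finsupp (hX : IsRational 𝒞 X) (J : Type u) : IsRational 𝒞 (J →₀ X) := by
  intro x
  induction x using Finsupp.induction_linear with
  | zero => exact ⟨0, fun f => by simp⟩
  | add x y hx hy =>
    obtain ⟨s, hs⟩ := hx
    obtain ⟨t, ht⟩ := hy
    exact ⟨s + t, fun f => by rw [smul_add, hs, ht, map_add]⟩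
  | single j x =>
    obtain ⟨t, ht⟩ := hX x
    refine ⟨t.mapRange (Finsupp.lsingle (R := 𝒞.Dualᵐᵒᵖ) j) (map_zero _), fun f => ?_⟩
    rw [rationalPairing_mapRange (Finsupp.lsingle j), ← ht, map_smul]
    rfl

/-- The representing element for `i x` has coefficients in `Y`, not in `X`. A dual basis replaces
them by elements of the form `x φ`, which do lie in `X`. -/
theorem IsRational.of_injective (hC : LocallyProjective A C) (hY : IsRational 𝒞 Y)
    (i : X →ₗ[𝒞.Dualᵐᵒᵖ] Y) (hi : Function.Injective i) : IsRational 𝒞 X := by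
  intro x
  obtain ⟨y, hy⟩ := hY (i x)
  obtain ⟨s, φ, hs⟩ := hC.exists_dualBasis (Submodule.span A (y.support : Set C))
    ⟨_, rfl⟩
  -- The witness is `∑ x φ_c ⊗ c`. If `i x` is represented by `∑ y_w ⊗ w`, it is correct because `f
  -- w = ∑ φ_c(w) f(c)` for each `w` in the support, after exchanging the two sums.
  refine ⟨∑ c ∈ s, Finsupp.single c (op (ofLin 𝒞 (φ c)) • x), fun f => hi ?_⟩
  rw [map_smul, hy, map_sum, map_sum]
  simp_rw [rationalPairing_single, map_smul, hy]
  simp only [rationalPairing, Finsupp.liftAddHom_apply, Finsupp.sum, Finset.smul_sum]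
  rw [Finset.sum_comm]
  refine Finset.sum_congr rfl fun w hw => ?_
  have hw : op (ofScalar 𝒞 (f.toLin w)) = ∑ c ∈ s, op (ofScalar 𝒞 (f.toLin (φ c w • c))) := by
    conv_lhs => rw [← hs w (Submodule.subset_span hw)]
    rw [map_sum, map_sum, ← opAddEquiv_apply, map_sum]
  rw [hw, DistribSMul.toAddMonoidHom_apply, Finset.sum_smul]
  refine Finset.sum_congr rfl fun c _ => ?_
  rw [DistribSMul.toAddMonoidHom_apply, ← mul_smul, ← op_mul, ← map_mul, LinearMap.map_smul]
  rfl

/-- A comodule is a rational module. -/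
theorem Comod.isRational (M : Comod 𝒞) : IsRational 𝒞 M.toModule := by
  intro (m : M)
  suffices h : ∀ t : BalTensor A M C, ∃ y : C →₀ M, ∀ f : 𝒞.Dual,
      BalTensor.contractRight f.toLin t = rationalPairing 𝒞 M f y from h (M.coact m)
  intro t
  induction t using BalTensor.induction_on with
  | zero => exact ⟨0, fun f => by simp⟩
  | tmul m c =>
    exact ⟨Finsupp.single c m, fun f => by
      rw [rationalPairing_single, M.ofScalar_smul, BalTensor.contractRight_tmul]⟩
  | add s t hs ht =>
    obtain ⟨a, ha⟩ := hs
    obtain ⟨b, hb⟩ := ht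
    exact ⟨a + b, fun f => by rw [map_add, map_add, ha, hb]⟩

/-- The coaction on a rational module. -/
theorem IsRational.exists_coact [Module Aᵐᵒᵖ X] (hX : IsRational 𝒞 X)
    (hA : ∀ (a : A) (x : X), op (ofScalar 𝒞 a) • x = op a • x) (x : X) :
    ∃ t : BalTensor A X C, ∀ f : 𝒞.Dual, BalTensor.contractRight f.toLin t = op f • x := by
  obtain ⟨y, hy⟩ := hX x
  refine ⟨y.sum fun c x => BalTensor.tmul A x c, fun f => ?_⟩
  rw [hy, rationalPairing, Finsupp.liftAddHom_apply, Finsupp.sum, Finsupp.sum, map_sum]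
  exact Finset.sum_congr rfl fun c _ => (hA _ _).symm

/-- Needed for the right `A`-linearity of a coaction that is known only through its contractions. -/
theorem contractRight_op_smul {M : Type*} [AddCommGroup M] [Module Aᵐᵒᵖ M] (a : A) (f : 𝒞.Dual)
    (t : BalTensor A M C) :
    BalTensor.contractRight f.toLin (op a • t) =
      BalTensor.contractRight (ofScalar 𝒞 a * f).toLin t := by
  induction t using BalTensor.induction_on with
  | zero => simp
  | tmul m c =>
    rw [BalTensor.right_smul_tmul, BalTensor.contractRight_tmul, BalTensor.contractRight_tmul,
      ofScalar_mul_apply]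
  | add s t hs ht => rw [smul_add, map_add, map_add, hs, ht]

/-- Contraction in the last variable as a left linear map `C ⊗ C → C`. -/
noncomputable def contractRightLin (f : 𝒞.Dual) : BalTensor A C C →ₗ[A] C where
  toFun := BalTensor.contractRight f.toLin
  map_add' := map_add _
  map_smul' a t := by
    induction t using BalTensor.induction_on with
    | zero => simp
    | tmul c d =>
      rw [BalTensor.left_smul_tmul, BalTensor.contractRight_tmul, BalTensor.contractRight_tmul]
      exact (smul_comm _ _ _).symm
    | add s t hs ht => rw [smul_add, map_add, map_add, hs, ht, smul_add]

theorem contractRight_eq_map_assoc {M : Type*} [AddCommGroup M] [Module Aᵐᵒᵖ M] (f : 𝒞.Dual)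
    (t : BalTensor A (BalTensor A M C) C) :
    BalTensor.contractRight f.toLin t =
      BalTensor.map LinearMap.id (contractRightLin f) (BalTensor.assoc t) := by
  induction t using BalTensor.induction_on with
  | zero => simp
  | add s t hs ht => rw [map_add, map_add, map_add, hs, ht]
  | tmul t c =>
    induction t using BalTensor.induction_on with
    | zero => simp
    | add s t hs ht => rw [BalTensor.add_tmul, map_add, map_add, map_add, hs, ht]
    | tmul m c' => rfl

/-- The comodule structure on a rational module. -/
noncomputable def IsRational.toComod (hC : LocallyProjective A C) (hX : IsRational 𝒞 X) :
    Comod 𝒞 :=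
  letI : Module Aᵐᵒᵖ X := Module.compHom X (ofScalar 𝒞).op
  have hA : ∀ (a : A) (x : X), op (ofScalar 𝒞 a) • x = op a • x := fun a x => rfl
  let ϱ : X → BalTensor A X C := fun x => (hX.exists_coact hA x).choose
  have hϱ : ∀ (x : X) (f : 𝒞.Dual), BalTensor.contractRight f.toLin (ϱ x) = op f • x :=
    fun x => (hX.exists_coact hA x).choose_spec
  let coact : X →ₗ[Aᵐᵒᵖ] BalTensor A X C :=
    { toFun := ϱ
      map_add' := fun x y => hC.ext_dual fun f : 𝒞.Dual => by
        rw [map_add]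
        exact ((hϱ _ f).trans (smul_add _ _ _)).trans (congrArg₂ _ (hϱ _ f) (hϱ _ f)).symm
      map_smul' := fun a x => hC.ext_dual fun f : 𝒞.Dual => by
        refine (hϱ _ f).trans (Eq.symm ?_)
        refine (contractRight_op_smul a.unop f (ϱ x)).trans ((hϱ _ _).trans ?_)
        exact mul_smul (op f) (op (ofScalar 𝒞 a.unop)) x }
  { carrier := X
    coact := coact
    coassoc := fun x => by
      -- Both sides are compared in `(X ⊗ C) ⊗ C`. Contracting the last factor with `f` and the
      -- other with `g` reduces coassociativity to `x (f g) = (x f) g`.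
      obtain ⟨u, hu⟩ := BalTensor.assoc_surjective
        (BalTensor.map (LinearMap.id : X →ₗ[Aᵐᵒᵖ] X) 𝒞.comul (coact x))
      rw [← hu]
      refine congrArg _ (hC.ext_dual fun f : 𝒞.Dual => ?_)
      have h1 := contractRight_eq_map_assoc (𝒞 := 𝒞) f u
      rw [hu] at h1
      refine Eq.trans ?_ h1.symm
      have h2 : BalTensor.map (LinearMap.id : X →ₗ[Aᵐᵒᵖ] X) (contractRightLin f)
          (BalTensor.map LinearMap.id 𝒞.comul (coact x)) =
          BalTensor.map LinearMap.id (Comod.actLin f) (coact x) := by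
        generalize coact x = t
        induction t using BalTensor.induction_on with
        | zero => simp
        | tmul m c => rfl
        | add s t hs ht => rw [map_add, map_add, map_add, hs, ht]
      rw [h2, BalTensor.contractRight_map]
      refine hC.ext_dual fun g : 𝒞.Dual => ?_
      have h3 : BalTensor.contractRight g.toLin (BalTensor.map (LinearMap.id : X →ₗ[Aᵐᵒᵖ] X)
          (Comod.actLin f) (coact x)) =
          BalTensor.contractRight (f * g).toLin (coact x) := by
        generalize coact x = t
        induction t using BalTensor.induction_on with
        | zero => simp
        | tmul m c => rfl
        | add s t hs ht => rw [map_add, map_add, map_add, hs, ht]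
      rw [h3]
      refine (hϱ _ g).trans (Eq.trans ?_ (hϱ x _).symm)
      rw [op_mul, mul_smul]
      exact congrArg _ (hϱ x f)
    counit := fun x => (hϱ x (1 : 𝒞.Dual)).trans (one_smul _ x) }

theorem IsRational.exists_equiv (hC : LocallyProjective A C) (hX : IsRational 𝒞 X) :
    ∃ M : Comod 𝒞, Nonempty (X ≃ₗ[𝒞.Dualᵐᵒᵖ] M.toModule) := by
  let : Module Aᵐᵒᵖ X := Module.compHom X (ofScalar 𝒞).op
  have hA : ∀ (a : A) (x : X), op (ofScalar 𝒞 a) • x = op a • x := fun a x => rfl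
  exact ⟨hX.toComod hC, ⟨{ AddEquiv.refl X with
    map_smul' := fun f x => ((hX.exists_coact hA x).choose_spec f.unop).symm }⟩⟩

/-- The modules subgenerated by `C` are the modules underlying comodules. -/
theorem exists_equiv_of_subgen (hC : LocallyProjective A C) {X : ModuleCat.{u} 𝒞.Dualᵐᵒᵖ}
    (hX : Subgen (Comod.regular 𝒞).toModule X) :
    ∃ M : Comod 𝒞, Nonempty (X ≃ₗ[𝒞.Dualᵐᵒᵖ] M.toModule) := by
  obtain ⟨Y, i, ⟨Λ, p, hp⟩, hi⟩ := hX
  exact IsRational.exists_equiv hC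
    ((((Comod.regular 𝒞).isRational.finsupp Λ).of_surjective p hp).of_injective hC i hi)

/-- Comodules are subgenerated by `C`. -/
theorem Comod.subgen_regular (M : Comod 𝒞) : Subgen (Comod.regular 𝒞).toModule M.toModule := by
  -- The coaction embeds `M` in `M ⊗_A C`, a quotient of a direct sum of copies of `C`. The
  -- `*C`-structure of `M ⊗_A C` enters only as that of the quotient by the kernel `K` of `p`.
  let p : (M →₀ (regular 𝒞).toModule) →+ BalTensor A M C :=
    (BalTensor.sumTmul A M C : (M →₀ C) →+ BalTensor A M C)
  have hps : ∀ (m : M) (c : C),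
      p (Finsupp.single m (show (regular 𝒞).toModule from c)) = BalTensor.tmul A m c :=
    BalTensor.sumTmul_single
  have hsurj : Function.Surjective p :=
    (BalTensor.sumTmul_surjective : Function.Surjective (BalTensor.sumTmul A M C))
  have hp : ∀ (f : 𝒞.Dual) (s : M →₀ (regular 𝒞).toModule), p (op f • s) =
      BalTensor.map (LinearMap.id : M →ₗ[Aᵐᵒᵖ] M) (actLin f) (p s) := by
    intro f s
    induction s using Finsupp.induction_linear with
    | zero => rw [smul_zero, map_zero, map_zero]
    | add s t hs ht =>
      rw [smul_add, map_add, map_add, hs, ht, map_add]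
    | single m c =>
      rw [Finsupp.smul_single]
      exact (hps m _).trans (congrArg (BalTensor.map LinearMap.id (actLin f)) (hps m c)).symm
  let K : Submodule 𝒞.Dualᵐᵒᵖ (M →₀ (regular 𝒞).toModule) :=
    { carrier := {s | p s = 0}
      zero_mem' := map_zero p
      add_mem' := fun {s t} hs ht => (map_add p s t).trans (by
        rw [show p s = 0 from hs, show p t = 0 from ht, add_zero])
      smul_mem' := fun f s hs => (hp f.unop s).trans (by
        rw [show p s = 0 from hs, map_zero]) }
  have hq : ∀ s t : M →₀ (regular 𝒞).toModule, p s = p t → K.mkQ s = K.mkQ t := by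
    intro s t h
    rw [← sub_eq_zero, ← map_sub]
    exact (Submodule.Quotient.mk_eq_zero K).2 ((map_sub p s t).trans (sub_eq_zero.2 h))
  have hσ : ∀ m : M, p (Function.surjInv hsurj (M.coact m)) = M.coact m :=
    fun m => Function.surjInv_eq hsurj _
  let i : M.toModule →ₗ[𝒞.Dualᵐᵒᵖ] (M →₀ (regular 𝒞).toModule) ⧸ K :=
    { toFun := fun m => K.mkQ (Function.surjInv hsurj (M.coact m))
      map_add' := fun m n => by
        rw [← map_add]
        refine hq _ _ ((hσ _).trans ((map_add p _ _).trans ?_).symm)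
        exact (congrArg₂ _ (hσ m) (hσ n)).trans (M.coact.map_add m n).symm
      map_smul' := fun f m => by
        rw [RingHom.id_apply, ← map_smul]
        refine hq _ _ ((hσ _).trans ((M.coact_act f.unop m).trans ?_))
        refine Eq.trans ?_ (hp f.unop _).symm
        exact congrArg _ (hσ m).symm }
  refine ⟨ModuleCat.of _ _, i, ⟨M, K.mkQ, K.mkQ_surjective⟩, ?_⟩
  rw [injective_iff_map_eq_zero]
  intro m hm
  -- The coaction is injective because the counit splits it.
  have h0 : M.coact m = 0 := (hσ m).symm.trans ((Submodule.Quotient.mk_eq_zero K).1 hm)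
  have h1 := M.counit m
  rw [h0, map_zero] at h1
  exact h1.symm

end Rational

end Comodules

/-! ### Evaluation `Hom_{*C}(A, X) ⊗_B A → X` and flatness of `A` over `B` -/

section Evaluation

variable {A : Type u} [Ring A] {C : Type u} [AddCommGroup C] [Module A C]
  [Module Aᵐᵒᵖ C] [SMulCommClass A Aᵐᵒᵖ C] {𝒞 : Coring A C} {x : C}

/-- The value at `1` of a colinear map `A → M` is coinvariant. -/
theorem Comod.apply_one_mem_coinvariants (hx : 𝒞.IsGrouplike x) {M : Comod 𝒞}
    (f : 𝒞.base hx ⟶ M) : f.1 (1 : A) ∈ M.coinvariants x := by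
  refine (f.2 (1 : A)).trans ?_
  change BalTensor.map f.1 LinearMap.id (BalTensor.tmul A (1 : A) (op 1 • x)) = _
  rw [op_one, one_smul]
  rfl

theorem Comod.apply_base (hx : 𝒞.IsGrouplike x) {M : Comod 𝒞}
    (f : 𝒞.base hx ⟶ M) (a : A) : f.1 a = op a • f.1 (1 : A) := by
  refine Eq.trans (congrArg f.1 ?_) (f.1.map_smul (op a) (1 : A))
  exact (one_mul a).symm

/-- The `*C`-endomorphisms of `A` are the left multiplications by coinvariants. -/
theorem exists_leftMul_eq (hC : LocallyProjective A C) (hx : 𝒞.IsGrouplike x)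
    (g : (𝒞.base hx).toModule →ₗ[𝒞.Dualᵐᵒᵖ] (𝒞.base hx).toModule) :
    ∃ b : 𝒞.coinvariants x, ∀ a : A, g a = (b : A) * a :=
  ⟨⟨_, (Comod.mem_coinvariants_base hx _).1
    (Comod.apply_one_mem_coinvariants hx (Comod.homOfLinear hC g))⟩,
    Comod.apply_base hx (Comod.homOfLinear hC g)⟩

/-- Left multiplication by a coinvariant as a `*C`-linear map. -/
noncomputable def leftMulLin (hx : 𝒞.IsGrouplike x) (b : 𝒞.coinvariants x) :
    (𝒞.base hx).toModule →ₗ[𝒞.Dualᵐᵒᵖ] (𝒞.base hx).toModule :=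
  (Comod.toModuleHom (𝒞.leftMulHom hx b)).hom

/-- Finitely supported functions with values in `A`, as elements of a `*C`-module. -/
def toBaseFinsupp (hx : 𝒞.IsGrouplike x) {J : Type u} (s : J →₀ A) :
    J →₀ (𝒞.base hx).toModule := s

/-- Since `K` is generated by `A`, `s` is a sum of values `h p` with `h : A → K`. Each coordinate of
`h` is an endomorphism of `A`, hence left multiplication by an element of `B`, so `h` has the form
`a ↦ d a` for a vector `d` over `B`. -/
theorem mem_closure_smulConst (hC : LocallyProjective A C) (hx : 𝒞.IsGrouplike x) {J : Type u}
    (K : Submodule 𝒞.Dualᵐᵒᵖ (J →₀ (𝒞.base hx).toModule))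
    (hK : Gen (𝒞.base hx).toModule (ModuleCat.of _ K))
    (s : J →₀ A) (hs : toBaseFinsupp hx s ∈ K) :
    s ∈ AddSubgroup.closure {t : J →₀ A | ∃ (d : J →₀ 𝒞.coinvariants x) (p : A),
      (∀ a : A, toBaseFinsupp hx (d.smulConst a) ∈ K) ∧
        t = d.smulConst p} := by
  obtain ⟨σ, hσ⟩ := gen_iff_exists_finsupp.1 hK ⟨_, hs⟩
  have h1 : (σ.sum fun h w => (h w).1) = s := by
    have h2 := congrArg K.subtype hσ
    rw [Finsupp.lsum_apply, Finsupp.sum, map_sum] at h2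
    exact h2
  rw [← h1]
  refine AddSubgroup.sum_mem _ fun h _ => AddSubgroup.subset_closure ?_
  choose b hb using fun j => exists_leftMul_eq hC hx
    ((Finsupp.lapply j).comp (K.subtype.comp h))
  -- The entry `b j` is the `j`-th coordinate of `h 1`, which is why `d` has finite support.
  let d : J →₀ 𝒞.coinvariants x := Finsupp.onFinset (h (1 : A)).1.support b fun j hj => by
    rw [Finsupp.mem_support_iff]
    intro h0
    apply hj
    have h3 := hb j (1 : A)
    rw [mul_one] at h3
    exact Subtype.ext (h3.symm.trans h0)
  have hd : ∀ a : A, d.smulConst a = (h a).1 := fun a => by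
    ext j
    exact (hb j a).symm
  refine ⟨d, σ h, fun a => ?_, (hd _).symm⟩
  have h2 : toBaseFinsupp hx (d.smulConst a) = (h a).1 := hd a
  rw [h2]
  exact (h a).2

/-- Left multiplications by `B` are `*C`-linear, so the solutions in `A^(J)` of a linear system over
`B` form a `*C`-submodule. Its being `A`-generated gives the equational criterion. -/
theorem leftFlat_of_gen (hC : LocallyProjective A C) (hx : 𝒞.IsGrouplike x)
    (hgen : ∀ (J : Type u) (K : Submodule 𝒞.Dualᵐᵒᵖ (J →₀ (𝒞.base hx).toModule)),
      Gen (𝒞.base hx).toModule (ModuleCat.of _ K)) :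
    LeftFlat (𝒞.coinvariants x) A := by
  refine leftFlat_of_equational fun J rel n hn => ?_
  let l : (J → 𝒞.coinvariants x) → (J →₀ (𝒞.base hx).toModule) →ₗ[𝒞.Dualᵐᵒᵖ] (𝒞.base hx).toModule :=
    fun ρ => Finsupp.lsum ℕ fun j => leftMulLin hx (ρ j)
  let K : Submodule 𝒞.Dualᵐᵒᵖ (J →₀ (𝒞.base hx).toModule) := ⨅ ρ ∈ rel, LinearMap.ker (l ρ)
  have hK : ∀ s : J →₀ A, toBaseFinsupp hx s ∈ K ↔
      ∀ ρ ∈ rel, (s.sum fun j y => ρ j • y) = 0 := by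
    intro s
    refine (Submodule.mem_iInf _).trans (forall_congr' fun ρ => ?_)
    exact Submodule.mem_iInf _
  refine AddSubgroup.closure_mono ?_
    (mem_closure_smulConst hC hx K (hgen J K) n ((hK n).2 hn))
  rintro _ ⟨d, p, hd, rfl⟩
  refine ⟨d, p, fun ρ hρ => ?_, rfl⟩
  -- Testing at `a = 1` shows that `d` itself solves the system over `B`.
  have h1 := (hK _).1 (hd 1) ρ hρ
  apply Subtype.ext
  refine Eq.trans ?_ ((Finsupp.sum_mapRange_index (by simp)).symm.trans h1)
  rw [Finsupp.sum, Finsupp.sum, AddSubmonoidClass.coe_finsetSum]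
  refine Finset.sum_congr rfl fun j _ => ?_
  change (ρ j : A) * (d j : A) = (ρ j : A) * ((d j : A) * 1)
  rw [mul_one]

/-- The evaluation map `Hom_{*C}(A, X) ⊗_B A → X`. -/
noncomputable def evalMap (hx : 𝒞.IsGrouplike x) (X : ModuleCat.{u} 𝒞.Dualᵐᵒᵖ) :
    BalTensor (𝒞.coinvariants x) ((𝒞.moduleHomFunctor hx).obj X) A →+ X :=
  BalTensor.lift
    (AddMonoidHom.mk' (fun (f : (𝒞.base hx).toModule ⟶ X) =>
        AddMonoidHom.mk' (fun a : A => f.hom a) f.hom.map_add)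
      (fun f g => by ext a; rfl))
    (fun f b a => rfl)

theorem evalMap_map (hx : 𝒞.IsGrouplike x) {X Y : ModuleCat.{u} 𝒞.Dualᵐᵒᵖ} (g : X ⟶ Y)
    (t : BalTensor (𝒞.coinvariants x) ((𝒞.moduleHomFunctor hx).obj X) A) :
    evalMap hx Y (BalTensor.map ((𝒞.moduleHomFunctor hx).map g).hom LinearMap.id t) =
      g.hom (evalMap hx X t) := by
  induction t using BalTensor.induction_on with
  | zero => simp
  | tmul f a => rfl
  | add s t hs ht => simp [hs, ht]

theorem evalMap_bijective_iff_of_equiv (hx : 𝒞.IsGrouplike x) {X Y : ModuleCat.{u} 𝒞.Dualᵐᵒᵖ}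
    (e : X ≃ₗ[𝒞.Dualᵐᵒᵖ] Y) :
    Function.Bijective (evalMap hx X) ↔ Function.Bijective (evalMap hx Y) := by
  have h1 : evalMap hx Y ∘ BalTensor.map ((𝒞.moduleHomFunctor hx).mapIso
      e.toModuleIso).toLinearEquiv.toLinearMap LinearMap.id = e ∘ evalMap hx X :=
    funext fun t => evalMap_map hx e.toModuleIso.hom t
  have h2 := BalTensor.map_bijective (N := A) ((𝒞.moduleHomFunctor hx).mapIso
      e.toModuleIso).toLinearEquiv
  rw [← Function.Bijective.of_comp_iff _ h2, h1, Function.Bijective.of_comp_iff' e.bijective]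

/-- The image of evaluation is the sum of the images of all homomorphisms `A → X`. -/
theorem evalMap_surjective_iff (hx : 𝒞.IsGrouplike x) (X : ModuleCat.{u} 𝒞.Dualᵐᵒᵖ) :
    Function.Surjective (evalMap hx X) ↔ Gen (𝒞.base hx).toModule X := by
  rw [gen_iff_exists_finsupp]
  constructor
  · intro h y
    obtain ⟨t, rfl⟩ := h y
    induction t using BalTensor.induction_on with
    | zero => exact ⟨0, by simp⟩
    | tmul f a =>
      exact ⟨Finsupp.single (ModuleCat.Hom.hom f) a, Finsupp.lsum_single _ _ _ _⟩
    | add s t hs ht =>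
      obtain ⟨a, ha⟩ := hs
      obtain ⟨b, hb⟩ := ht
      exact ⟨a + b, by rw [map_add, ha, hb, map_add]⟩
  · intro h y
    obtain ⟨s, rfl⟩ := h y
    induction s using Finsupp.induction_linear with
    | zero => exact ⟨0, by simp⟩
    | single f a =>
      exact ⟨BalTensor.tmul (𝒞.coinvariants x) (M := (𝒞.moduleHomFunctor hx).obj X)
        (ModuleCat.ofHom f) a,
        (Finsupp.lsum_single ℕ (fun f : (𝒞.base hx).toModule →ₗ[𝒞.Dualᵐᵒᵖ] X => f) f a).symm⟩
    | add s t hs ht =>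
      obtain ⟨a, ha⟩ := hs
      obtain ⟨b, hb⟩ := ht
      exact ⟨a + b, by rw [map_add, ha, hb, map_add]⟩

/-- Apply `mem_closure_smulConst` to the kernel of `A^(Hom(A, X)) → X`. A vector `d` with `d a` in
the kernel for all `a` means `∑ f d_f = 0` in `Hom(A, X)`, so `∑ f ⊗ d_f p = (∑ f d_f) ⊗ p = 0`. -/
theorem evalMap_injective_of_gen (hC : LocallyProjective A C) (hx : 𝒞.IsGrouplike x)
    (hgen : ∀ (J : Type u) (K : Submodule 𝒞.Dualᵐᵒᵖ (J →₀ (𝒞.base hx).toModule)),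
      Gen (𝒞.base hx).toModule (ModuleCat.of _ K)) (X : ModuleCat.{u} 𝒞.Dualᵐᵒᵖ) :
    Function.Injective (evalMap hx X) := by
  rw [injective_iff_map_eq_zero]
  intro t ht
  obtain ⟨s, rfl⟩ := BalTensor.sumTmul_surjective t
  let H := (𝒞.moduleHomFunctor hx).obj X
  let l : (H →₀ (𝒞.base hx).toModule) →ₗ[𝒞.Dualᵐᵒᵖ] X :=
    Finsupp.lsum ℕ fun f : H => ModuleCat.Hom.hom f
  have hl : ∀ s : H →₀ A, l s = evalMap hx X (BalTensor.sumTmul _ _ _ s) := by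
    intro s
    induction s using Finsupp.induction_linear with
    | zero => exact (map_zero l).trans (by simp)
    | single f a =>
      rw [BalTensor.sumTmul_single]
      exact Finsupp.lsum_single _ _ _ _
    | add s t hs ht => rw [map_add, map_add, ← hs, ← ht]; exact map_add l _ _
  have hmem := mem_closure_smulConst hC hx (LinearMap.ker l) (hgen _ _) s ((hl s).trans ht)
  suffices h : AddSubgroup.closure _ ≤ (BalTensor.sumTmul (𝒞.coinvariants x) H A).ker from h hmem
  rw [AddSubgroup.closure_le]
  rintro _ ⟨d, p, hd, rfl⟩
  change BalTensor.sumTmul (𝒞.coinvariants x) H A _ = 0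
  rw [BalTensor.sumTmul_smulConst]
  have h0 : BalTensor.rsum (𝒞.coinvariants x) H d = 0 := by
    refine ModuleCat.hom_ext (LinearMap.ext fun (a : A) => ?_)
    have h1 := (hl (d.smulConst a)).symm.trans (hd a)
    rw [BalTensor.sumTmul_smulConst] at h1
    exact h1
  rw [h0, BalTensor.zero_tmul]

/-! ### `Hom_{*C}(A, -)` on `Gen(A)`: fullness, faithfulness, submodules -/

/-- The right `*C`-module `V ⊗_B A`. -/
noncomputable def tensorModule (hx : 𝒞.IsGrouplike x)
    (V : ModuleCat.{u} (𝒞.coinvariants x)ᵐᵒᵖ) : ModuleCat.{u} 𝒞.Dualᵐᵒᵖ :=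
  letI : Module 𝒞.Dualᵐᵒᵖ A := inferInstanceAs (Module 𝒞.Dualᵐᵒᵖ (𝒞.base hx))
  haveI : SMulCommClass (𝒞.coinvariants x) 𝒞.Dualᵐᵒᵖ A :=
    ⟨fun b f a => (leftMulLin hx b).map_smul f a⟩
  ModuleCat.of 𝒞.Dualᵐᵒᵖ (BalTensor (𝒞.coinvariants x) V A)

/-- The map `a ↦ v ⊗ a`. -/
noncomputable def tensorInsert (hx : 𝒞.IsGrouplike x) (V : ModuleCat.{u} (𝒞.coinvariants x)ᵐᵒᵖ)
    (v : V) : (𝒞.base hx).toModule →ₗ[𝒞.Dualᵐᵒᵖ] tensorModule hx V where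
  toFun a := BalTensor.tmul (𝒞.coinvariants x) (N := A) v a
  map_add' a b := BalTensor.tmul_add (N := A) v a b
  map_smul' _ _ := rfl

theorem gen_tensorModule (hx : 𝒞.IsGrouplike x) (V : ModuleCat.{u} (𝒞.coinvariants x)ᵐᵒᵖ) :
    Gen (𝒞.base hx).toModule (tensorModule hx V) :=
  ⟨V, Finsupp.lsum ℕ (tensorInsert hx V),
    BalTensor.sumTmul_surjective (R := 𝒞.coinvariants x) (M := V) (N := A)⟩

/-- The unit `V → Hom_{*C}(A, V ⊗_B A)`. -/
noncomputable def tensorUnit (hx : 𝒞.IsGrouplike x) (V : ModuleCat.{u} (𝒞.coinvariants x)ᵐᵒᵖ) :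
    V ⟶ (𝒞.moduleHomFunctor hx).obj (tensorModule hx V) :=
  ModuleCat.ofHom (Y := (𝒞.moduleHomFunctor hx).obj (tensorModule hx V))
    { toFun := fun v => ModuleCat.ofHom (Y := tensorModule hx V) (tensorInsert hx V v)
      map_add' := fun v w => ModuleCat.hom_ext (LinearMap.ext fun a =>
        BalTensor.add_tmul (N := A) v w a)
      map_smul' := fun b v => ModuleCat.hom_ext (LinearMap.ext fun a =>
        BalTensor.smul_tmul (N := A) b.unop v a) }

/-- If `Hom_{*C}(A, -)` is full on `Gen(A)`, then evaluation is injective on `Gen(A)`. -/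
theorem evalMap_injective_of_full (hx : 𝒞.IsGrouplike x)
    (hfull : ((Gen (𝒞.base hx).toModule).ι ⋙ 𝒞.moduleHomFunctor hx).Full)
    (X : ModuleCat.{u} 𝒞.Dualᵐᵒᵖ) (hX : Gen (𝒞.base hx).toModule X) :
    Function.Injective (evalMap hx X) := by
  let V := (𝒞.moduleHomFunctor hx).obj X
  -- Fullness realises the unit at `V = Hom(A, X)` by a map `s : X → V ⊗_B A`. By construction `s (f
  -- a) = f ⊗ a`, so `s` is a left inverse of evaluation.
  obtain ⟨s, hs⟩ := hfull.map_surjective (X := ⟨X, hX⟩)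
    (Y := ⟨tensorModule hx V, gen_tensorModule hx V⟩) (tensorUnit hx V)
  have h : ∀ t, s.hom.hom (evalMap hx X t) = t := by
    intro t
    induction t using BalTensor.induction_on with
    | zero => rw [map_zero, map_zero]; rfl
    | tmul f a =>
      let ev : (V ⟶ (𝒞.moduleHomFunctor hx).obj (tensorModule hx V)) →
          ((𝒞.base hx).toModule ⟶ tensorModule hx V) := fun φ => φ.hom f
      exact congrArg (fun φ => (ev φ).hom a) hs
    | add s t hs ht => rw [map_add, map_add, hs, ht]; rfl
  exact Function.LeftInverse.injective h

/-- If evaluation is bijective on `Gen(A)`, then `Hom_{*C}(A, -)` is full on `Gen(A)`. -/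
theorem full_of_evalMap_bijective (hx : 𝒞.IsGrouplike x)
    (hbij : ∀ X, Gen (𝒞.base hx).toModule X → Function.Bijective (evalMap hx X)) :
    ((Gen (𝒞.base hx).toModule).ι ⋙ 𝒞.moduleHomFunctor hx).Full where
  map_surjective {X Y} φ := by
    let e := AddEquiv.ofBijective (evalMap hx X.obj) (hbij X.obj X.property)
    let q := (evalMap hx Y.obj).comp (BalTensor.map (N := A) φ.hom LinearMap.id)
    have he : ∀ t, e.symm (evalMap hx X.obj t) = t := e.symm_apply_apply
    -- The preimage of `φ` is forced by `f a ↦ (φ f) a`: conjugate `φ ⊗ A` by the evaluation maps.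
    let s : X.obj →ₗ[𝒞.Dualᵐᵒᵖ] Y.obj :=
      { toFun := fun m => q (e.symm m)
        map_add' := fun m n => by rw [map_add, map_add]
        map_smul' := fun f m => by
          obtain ⟨t, rfl⟩ := (hbij X.obj X.property).2 m
          rw [he, RingHom.id_apply]
          induction t using BalTensor.induction_on with
          | zero => simp
          | tmul g a =>
            let g' : (𝒞.base hx).toModule ⟶ X.obj := g
            have h1 : f • evalMap hx X.obj (BalTensor.tmul _ g a) =
                evalMap hx X.obj (BalTensor.tmul (𝒞.coinvariants x) g
                  (show A from f • (show (𝒞.base hx).toModule from a))) :=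
              (g'.hom.map_smul f a).symm
            rw [h1, he]
            exact LinearMap.map_smul (ModuleCat.Hom.hom
              (show (𝒞.base hx).toModule ⟶ Y.obj from φ.hom g)) f a
          | add s t hs ht => rw [map_add, smul_add, map_add, map_add, hs, ht, map_add, smul_add] }
    refine ⟨ObjectProperty.homMk (ModuleCat.ofHom s), ?_⟩
    refine ModuleCat.hom_ext (LinearMap.ext fun g => ModuleCat.hom_ext (LinearMap.ext fun a => ?_))
    have h2 : s (evalMap hx X.obj (BalTensor.tmul (𝒞.coinvariants x) g (a : A))) =
        q (BalTensor.tmul (𝒞.coinvariants x) g (a : A)) := congrArg q (he _)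
    exact h2

/-- On an `A`-generated module a morphism is determined by its composites with maps from `A`. -/
theorem faithful_moduleHomFunctor (hx : 𝒞.IsGrouplike x) :
    ((Gen (𝒞.base hx).toModule).ι ⋙ 𝒞.moduleHomFunctor hx).Faithful where
  map_injective {X Y} φ ψ h := by
    refine ObjectProperty.hom_ext _ (ModuleCat.hom_ext (LinearMap.ext fun m => ?_))
    obtain ⟨t, rfl⟩ := (evalMap_surjective_iff hx X.obj).2 X.property m
    rw [← evalMap_map, ← evalMap_map]
    exact congrArg (fun χ : (𝒞.moduleHomFunctor hx).obj X.obj ⟶ (𝒞.moduleHomFunctor hx).obj Y.obj =>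
      evalMap hx Y.obj (BalTensor.map χ.hom LinearMap.id t)) h

/-- If `A` is flat over `B` and evaluation is bijective on `Gen(A)`, then `Gen(A)` is closed under
submodules. -/
theorem gen_of_subgen (hx : 𝒞.IsGrouplike x) (hflat : LeftFlat (𝒞.coinvariants x) A)
    (hbij : ∀ X, Gen (𝒞.base hx).toModule X → Function.Bijective (evalMap hx X))
    {X : ModuleCat.{u} 𝒞.Dualᵐᵒᵖ} (hX : Subgen (𝒞.base hx).toModule X) :
    Gen (𝒞.base hx).toModule X := by
  obtain ⟨Y, i, hY, hi⟩ := hX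
  let Z := ModuleCat.of 𝒞.Dualᵐᵒᵖ (Y ⧸ LinearMap.range i)
  let q : Y ⟶ Z := ModuleCat.ofHom (LinearMap.range i).mkQ
  have hZ : Gen (𝒞.base hx).toModule Z := hY.of_surjective _ (Submodule.mkQ_surjective _)
  rw [← evalMap_surjective_iff hx]
  intro m
  obtain ⟨t, ht⟩ := (hbij Y hY).2 (i m)
  -- The image of `t` over the quotient `Z = Y / X` evaluates to the class of `i m`, which is zero;
  -- evaluation is injective at `Z`, as `Z` is again `A`-generated.
  have hq : BalTensor.map ((𝒞.moduleHomFunctor hx).map q).hom LinearMap.id t = 0 := by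
    apply (hbij Z hZ).1
    rw [evalMap_map, ht, map_zero]
    exact (Submodule.Quotient.mk_eq_zero _).2 ⟨m, rfl⟩
  -- Left exactness of `Hom(A, -)` followed by flatness of `A` gives exactness at `Hom(A, Y) ⊗_B A`.
  obtain ⟨u, hu⟩ := hflat.exists_map_eq_of_exact
    ((𝒞.moduleHomFunctor hx).map (ModuleCat.ofHom i)).hom _ (fun f hf => by
      have hf' : ∀ a, ModuleCat.Hom.hom (show (𝒞.base hx).toModule ⟶ Y from f) a ∈
          LinearMap.range i := fun a =>
        (Submodule.Quotient.mk_eq_zero _).1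
          (congrArg (fun g : (𝒞.base hx).toModule ⟶ Z => g.hom a) hf)
      let e := LinearEquiv.ofInjective i hi
      refine ⟨ModuleCat.ofHom (e.symm.toLinearMap.comp (LinearMap.codRestrict _ _ hf')), ?_⟩
      refine ModuleCat.hom_ext (LinearMap.ext fun a => ?_)
      exact congrArg Subtype.val (e.apply_symm_apply _)) t hq
  refine ⟨u, hi ?_⟩
  rw [← ht, ← hu, evalMap_map]
  rfl

end Evaluation

/-! ### Coinvariants, the Galois map and generators -/

section Structure

variable {A : Type u} [Ring A] {C : Type u} [AddCommGroup C] [Module A C]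
  [Module Aᵐᵒᵖ C] [SMulCommClass A Aᵐᵒᵖ C] {𝒞 : Coring A C} {x : C}

/-- Colinear maps `A → M` are the same as `*C`-linear maps. -/
noncomputable def homFunctorEquiv (hC : LocallyProjective A C) (hx : 𝒞.IsGrouplike x)
    (M : Comod 𝒞) : (𝒞.homFunctor hx).obj M ≃ₗ[(𝒞.coinvariants x)ᵐᵒᵖ]
      (𝒞.moduleHomFunctor hx).obj M.toModule where
  toFun f := Comod.toModuleHom (M := 𝒞.base hx) f
  invFun g := Comod.homOfLinear hC (M := 𝒞.base hx) (ModuleCat.Hom.hom g)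
  map_add' _ _ := rfl
  map_smul' _ _ := rfl
  left_inv _ := rfl
  right_inv _ := rfl

theorem psi'_bijective_iff (hC : LocallyProjective A C) (hx : 𝒞.IsGrouplike x) (M : Comod 𝒞) :
    Function.Bijective (M.psi' hx) ↔ Function.Bijective (evalMap hx M.toModule) := by
  have h : M.psi' hx = (evalMap hx M.toModule).comp
      (BalTensor.map (homFunctorEquiv hC hx M).toLinearMap LinearMap.id) :=
    BalTensor.hom_ext fun f a => rfl
  exact (iff_of_eq (congrArg Function.Bijective (funext (DFunLike.congr_fun h)))).trans
    (Function.Bijective.of_comp_iff _ (BalTensor.map_bijective (homFunctorEquiv hC hx M)))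

/-- The colinear map `A → M`, `a ↦ m a`, for a coinvariant `m`. -/
def Comod.homOfCoinvariant (hx : 𝒞.IsGrouplike x) (M : Comod 𝒞) (m : M.coinvariants x) :
    𝒞.base hx ⟶ M :=
  ⟨{  toFun := fun a : A => op a • (m : M)
      map_add' := fun (a b : A) => add_smul (op a) (op b) (m : M)
      map_smul' := fun a (b : A) => mul_smul a (op b) (m : M) }, fun a : A => by
    have hm : M.coact (m : M) = BalTensor.tmul A (m : M) x := m.2
    change M.coact (op a • (m : M)) = BalTensor.tmul A (op (1 : A) • (m : M)) (op a • x)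
    rw [map_smul, hm, op_one, one_smul]
    rfl⟩

/-- Colinear maps `A → M` correspond to coinvariants of `M`. -/
noncomputable def homFunctorEquivCoinvariants (hx : 𝒞.IsGrouplike x) (M : Comod 𝒞) :
    (𝒞.homFunctor hx).obj M ≃ₗ[(𝒞.coinvariants x)ᵐᵒᵖ] M.coinvariants x where
  toFun f := ⟨_, Comod.apply_one_mem_coinvariants hx (M := M) f⟩
  invFun m := M.homOfCoinvariant hx m
  map_add' _ _ := rfl
  map_smul' b f := Subtype.ext (by
    let f' : 𝒞.base hx ⟶ M := f
    refine Eq.trans ?_ (Comod.apply_base hx f' (b.unop : A))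
    exact congrArg f'.1 (mul_one (b.unop : A)))
  left_inv f := Subtype.ext (LinearMap.ext fun a => (Comod.apply_base hx (M := M) f a).symm)
  right_inv m := Subtype.ext (one_smul Aᵐᵒᵖ (m : M))

theorem psi_comp_homFunctorEquivCoinvariants (hx : 𝒞.IsGrouplike x) (M : Comod 𝒞) :
    (M.psi x).comp (BalTensor.map (homFunctorEquivCoinvariants hx M).toLinearMap LinearMap.id) =
      M.psi' hx :=
  BalTensor.hom_ext fun f a => (Comod.apply_base hx (M := M) f a).symm

theorem psi_bijective_iff (hx : 𝒞.IsGrouplike x) (M : Comod 𝒞) :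
    Function.Bijective (M.psi x) ↔ Function.Bijective (M.psi' hx) := by
  rw [← psi_comp_homFunctorEquivCoinvariants, AddMonoidHom.coe_comp,
    Function.Bijective.of_comp_iff _ (BalTensor.map_bijective _)]

/-- The coinvariants of `C` are `A x`. -/
noncomputable def coinvariantsRegularEquiv (hx : 𝒞.IsGrouplike x) :
    A ≃ₗ[(𝒞.coinvariants x)ᵐᵒᵖ] (Comod.regular 𝒞).coinvariants x where
  toFun a := ⟨a • x, by
    change 𝒞.comul (a • x) = BalTensor.tmul A (a • x) x
    rw [map_smul, hx.comul_eq]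
    rfl⟩
  invFun c := 𝒞.counit c.1
  map_add' a b := Subtype.ext (add_smul a b x)
  map_smul' b a := Subtype.ext (by
    have hb : (b.unop : A) • x = op (b.unop : A) • x := b.unop.2
    change (a * (b.unop : A)) • x = op (b.unop : A) • a • x
    rw [mul_smul, hb, smul_comm])
  left_inv a := by
    change 𝒞.counit (a • x) = a
    rw [map_smul, hx.counit_eq, smul_eq_mul, mul_one]
  right_inv c := Subtype.ext (by
    have hc : 𝒞.comul c.1 = BalTensor.tmul A c.1 x := c.2
    have h := 𝒞.counit_left c.1
    rw [hc] at h
    exact h)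

/-- Under `A ≅ C^{co C}`, `a ↦ a x`, the Galois map is `Ψ_C`. -/
theorem Coring.isGalois_iff_psi'_bijective (hx : 𝒞.IsGrouplike x) :
    𝒞.IsGalois x ↔ Function.Bijective ((Comod.regular 𝒞).psi' hx) := by
  have h : 𝒞.galoisMap x = ((Comod.regular 𝒞).psi x).comp
      (BalTensor.map (coinvariantsRegularEquiv hx).toLinearMap LinearMap.id) :=
    BalTensor.hom_ext fun a' a => smul_comm a' (op a) x
  rw [← psi_bijective_iff]
  exact (iff_of_eq (congrArg Function.Bijective (funext (DFunLike.congr_fun h)))).trans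
    (Function.Bijective.of_comp_iff _ (BalTensor.map_bijective (coinvariantsRegularEquiv hx)))

theorem isSeparator_iff_faithful_homFunctor (hx : 𝒞.IsGrouplike x) :
    IsSeparator (𝒞.base hx) ↔ (𝒞.homFunctor hx).Faithful := by
  rw [isSeparator_iff_faithful_preadditiveCoyonedaObj]
  constructor
  · intro h
    exact Functor.Faithful.comp _ _
  · intro h
    have : (preadditiveCoyonedaObj (𝒞.base hx) ⋙
      ModuleCat.restrictScalars (𝒞.leftMulHom hx).op).Faithful := h
    exact Functor.Faithful.of_comp _ (ModuleCat.restrictScalars (𝒞.leftMulHom hx).op)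

/-- Every element of `M` is a sum of values of colinear maps from `A`, so a map killed by all of
these is zero. -/
theorem isSeparator_of_psi'_surjective (hx : 𝒞.IsGrouplike x)
    (h : ∀ M : Comod 𝒞, Function.Surjective (M.psi' hx)) : IsSeparator (𝒞.base hx) := by
  rw [Preadditive.isSeparator_iff]
  intro M N f hf
  refine Subtype.ext (LinearMap.ext fun m => ?_)
  obtain ⟨t, rfl⟩ := h M m
  induction t using BalTensor.induction_on with
  | zero => rw [map_zero, map_zero, map_zero]
  | tmul g a =>
    exact DFunLike.congr_fun (congrArg Subtype.val (hf g)) a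
  | add s t hs ht => rw [map_add, map_add, map_add, hs, ht]

/-- The class `σ[C]` is closed under quotients, so `M` modulo the trace of `A` is again a comodule.
The projection onto it kills every map from `A`, hence is zero, and the trace is all of `M`. -/
theorem gen_of_isSeparator (hC : LocallyProjective A C) (hx : 𝒞.IsGrouplike x)
    (h : IsSeparator (𝒞.base hx)) {X : ModuleCat.{u} 𝒞.Dualᵐᵒᵖ}
    (hX : Subgen (Comod.regular 𝒞).toModule X) : Gen (𝒞.base hx).toModule X := by
  obtain ⟨M, ⟨e⟩⟩ := exists_equiv_of_subgen hC hX
  suffices hM : Gen (𝒞.base hx).toModule M.toModule from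
    hM.of_surjective e.symm.toLinearMap e.symm.surjective
  let l : (((𝒞.base hx).toModule →ₗ[𝒞.Dualᵐᵒᵖ] M.toModule) →₀ (𝒞.base hx).toModule)
      →ₗ[𝒞.Dualᵐᵒᵖ] M.toModule := Finsupp.lsum ℕ fun f => f
  obtain ⟨N, ⟨e'⟩⟩ := exists_equiv_of_subgen hC (X := ModuleCat.of _ (M.toModule ⧸ LinearMap.range l))
    (M.subgen_regular.of_surjective (LinearMap.range l).mkQ (Submodule.mkQ_surjective _))
  let q : M.toModule →ₗ[𝒞.Dualᵐᵒᵖ] N.toModule := e'.toLinearMap.comp (LinearMap.range l).mkQ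
  rw [Preadditive.isSeparator_iff] at h
  have hq := h (Comod.homOfLinear hC q) fun g => Subtype.ext (LinearMap.ext fun a => by
    refine (congrArg e' ?_).trans (map_zero e')
    refine (Submodule.Quotient.mk_eq_zero _).2 ⟨Finsupp.single (Comod.toModuleHom g).hom a, ?_⟩
    exact Finsupp.lsum_single _ _ _ _)
  refine ⟨_, l, fun m => ?_⟩
  have h1 : q m = 0 := DFunLike.congr_fun (congrArg Subtype.val hq) m
  exact (Submodule.Quotient.mk_eq_zero _).1 (e'.injective (h1.trans (map_zero e').symm))

/-! ### The Galois isomorphism with coefficients, and surjectivity of `Ψ` -/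

/-- The map `M ⊗_B A → M ⊗_A C`, `m ⊗ a ↦ m ⊗ x a`. -/
noncomputable def tensorGalois (𝒞 : Coring A C) (x : C) {M : Type u} [AddCommGroup M]
    [Module Aᵐᵒᵖ M] [Module (𝒞.coinvariants x)ᵐᵒᵖ M]
    (hM : ∀ (b : 𝒞.coinvariants x) (m : M), op b • m = op (b : A) • m) :
    BalTensor (𝒞.coinvariants x) M A →+ BalTensor A M C :=
  BalTensor.lift
    (AddMonoidHom.mk' (fun m => AddMonoidHom.mk' (fun a => BalTensor.tmul A m (op a • x))
        (fun a b => by rw [MulOpposite.op_add, add_smul, BalTensor.tmul_add]))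
      (fun m n => by ext a; simp [BalTensor.add_tmul]))
    (fun m b a => by
      have hb : (b : A) • x = op (b : A) • x := b.2
      change BalTensor.tmul A (op b • m) (op a • x) = BalTensor.tmul A m (op ((b : A) * a) • x)
      rw [hM, BalTensor.smul_tmul, smul_comm, hb, MulOpposite.op_mul, mul_smul])

section TensorGalois

variable {M : Type u} [AddCommGroup M] [Module Aᵐᵒᵖ M] [Module (𝒞.coinvariants x)ᵐᵒᵖ M]
  (hM : ∀ (b : 𝒞.coinvariants x) (m : M), op b • m = op (b : A) • m)

theorem tensorGalois_tmul (m : M) (a : A) :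
    tensorGalois 𝒞 x hM (BalTensor.tmul (𝒞.coinvariants x) m a) =
      BalTensor.tmul A m (op a • x) := rfl

/-- The map `a ↦ m a`. -/
def orbitMap (m : M) : A →ₗ[(𝒞.coinvariants x)ᵐᵒᵖ] M where
  toFun a := op a • m
  map_add' a b := by rw [MulOpposite.op_add, add_smul]
  map_smul' b a := (mul_smul (op (b.unop : A)) (op a) m).trans (hM b.unop _).symm

@[simp]
theorem orbitMap_apply (m : M) (a : A) : orbitMap hM m a = op a • m := rfl

/-- If `c = ∑ a' x a`, then `m ⊗ c = ∑ m a' ⊗ x a`. -/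
theorem tensorGalois_surjective (hβ : 𝒞.IsGalois x) :
    Function.Surjective (tensorGalois 𝒞 x hM) := by
  rw [← AddMonoidHom.range_eq_top, eq_top_iff]
  rintro t -
  induction t using BalTensor.induction_on with
  | zero => exact zero_mem _
  | add s t hs ht => exact add_mem hs ht
  | tmul m c =>
    obtain ⟨t, rfl⟩ := hβ.2 c
    refine ⟨BalTensor.map (orbitMap hM m) LinearMap.id t, ?_⟩
    induction t using BalTensor.induction_on with
    | zero => simp
    | add s t hs ht => rw [map_add, map_add, hs, ht, map_add, BalTensor.tmul_add]
    | tmul a' a => exact BalTensor.smul_tmul a' m (op a • x)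

theorem tensorGalois_injective (hβ : 𝒞.IsGalois x) :
    Function.Injective (tensorGalois 𝒞 x hM) := by
  let e := AddEquiv.ofBijective (𝒞.galoisMap x) hβ
  let lmul : A → A →ₗ[(𝒞.coinvariants x)ᵐᵒᵖ] A := fun a =>
    { toFun := fun b => a * b
      map_add' := mul_add a
      map_smul' := fun b c => (mul_assoc a c (b.unop : A)).symm }
  -- Left `A`-linearity of `β⁻¹`. It makes the candidate inverse `δ`, which sends `m ⊗ c` to `m
  -- β⁻¹(c)`, balanced over `A`.
  have he : ∀ (a : A) (c : C), e.symm (a • c) =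
      BalTensor.map (lmul a) LinearMap.id (e.symm c) := by
    intro a c
    obtain ⟨t, rfl⟩ := e.surjective c
    rw [e.symm_apply_apply, e.symm_apply_eq]
    induction t using BalTensor.induction_on with
    | zero => simp
    | add s t hs ht => rw [map_add, smul_add, map_add, map_add, hs, ht]
    | tmul a' a'' => exact (mul_smul a a' (op a'' • x)).symm
  let δ : BalTensor A M C →+ BalTensor (𝒞.coinvariants x) M A := BalTensor.lift
    (AddMonoidHom.mk' (fun m => (BalTensor.map (orbitMap hM m) LinearMap.id).comp
        e.symm.toAddMonoidHom)
      (fun m n => by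
        ext c
        change BalTensor.map (orbitMap hM (m + n)) LinearMap.id (e.symm c) =
          BalTensor.map (orbitMap hM m) LinearMap.id (e.symm c) +
            BalTensor.map (orbitMap hM n) LinearMap.id (e.symm c)
        generalize e.symm c = t
        rw [← AddMonoidHom.add_apply]
        congr 1
        refine BalTensor.hom_ext fun a' a => ?_
        simp [BalTensor.add_tmul]))
    (fun m a c => by
      change BalTensor.map (orbitMap hM (op a • m)) LinearMap.id (e.symm c) =
          BalTensor.map (orbitMap hM m) LinearMap.id (e.symm (a • c))
      rw [he]
      generalize e.symm c = t
      rw [← AddMonoidHom.comp_apply]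
      congr 1
      refine BalTensor.hom_ext fun a' a'' => ?_
      exact congrArg (fun m => BalTensor.tmul (𝒞.coinvariants x) m a'')
        (mul_smul (op a') (op a) m).symm)
  have h : δ.comp (tensorGalois 𝒞 x hM) = AddMonoidHom.id _ := BalTensor.hom_ext fun m a => by
    have h1 : e.symm (op a • x) = BalTensor.tmul (𝒞.coinvariants x) (1 : A) a :=
      e.symm_apply_eq.2 (one_smul A (op a • x)).symm
    change BalTensor.map (orbitMap hM m) LinearMap.id (e.symm (op a • x)) = _
    rw [h1]
    simp
  exact Function.LeftInverse.injective (g := δ) fun t => DFunLike.congr_fun h t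

end TensorGalois

/-- The coinvariants are the kernel of the `B`-linear map `d : m ↦ ϱ(m) - m ⊗ x`, and flatness
preserves this exact sequence. Write `ϱ(m)` as the image of some `t` in `M ⊗_B A`; coassociativity
says `(d ⊗ A) t = 0`, so `t` comes from `M^{co C} ⊗_B A`, and the counit shows that its preimage
maps to `m`. -/
theorem psi_surjective_of_isGalois (hC : LocallyProjective A C) (hx : 𝒞.IsGrouplike x)
    (hflat : LeftFlat (𝒞.coinvariants x) A) (hβ : 𝒞.IsGalois x) (M : Comod 𝒞) :
    Function.Surjective (M.psi x) := by
  let : Module (𝒞.coinvariants x)ᵐᵒᵖ M := Module.compHom M (𝒞.coinvariants x).subtype.op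
  let : Module (𝒞.coinvariants x)ᵐᵒᵖ (BalTensor A M C) :=
    Module.compHom _ (𝒞.coinvariants x).subtype.op
  have hM : ∀ (b : 𝒞.coinvariants x) (m : M), op b • m = op (b : A) • m := fun _ _ => rfl
  have hMC : ∀ (b : 𝒞.coinvariants x) (m : BalTensor A M C), op b • m = op (b : A) • m :=
    fun _ _ => rfl
  let d : M →ₗ[(𝒞.coinvariants x)ᵐᵒᵖ] BalTensor A M C :=
    { toFun := fun m => M.coact m - BalTensor.tmul A m x
      map_add' := fun m n => by rw [map_add, BalTensor.add_tmul]; abel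
      map_smul' := fun b m => by
        have hb : (b.unop : A) • x = op (b.unop : A) • x := b.unop.2
        change M.coact (op (b.unop : A) • m) - BalTensor.tmul A (op (b.unop : A) • m) x =
          op (b.unop : A) • (M.coact m - BalTensor.tmul A m x)
        rw [map_smul, smul_sub, BalTensor.smul_tmul, hb, BalTensor.right_smul_tmul] }
  let ι : M.coinvariants x →ₗ[(𝒞.coinvariants x)ᵐᵒᵖ] M :=
    { toFun := Subtype.val
      map_add' := fun _ _ => rfl
      map_smul' := fun _ _ => rfl }
  intro m
  obtain ⟨t, ht⟩ := tensorGalois_surjective hM hβ (M.coact m)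
  have hact : ∀ (f : 𝒞.Dual) (a : A),
      Comod.actLin f (op a • x) = op (f.toLin (op a • x)) • x := by
    intro f a
    change BalTensor.contractRight f.toLin (𝒞.comul (op a • x)) = _
    rw [𝒞.comul_op_smul, hx.comul_eq]
    rfl
  have key : ∀ (f : 𝒞.Dual) (t : BalTensor (𝒞.coinvariants x) M A),
      -- For `t` representing `ϱ(m)`, the right-hand side is the difference of the two expressions
      -- for `ϱ(m f)` identified by `Comod.coact_act`.
      BalTensor.contractRight f.toLin (tensorGalois 𝒞 x hMC (BalTensor.map d LinearMap.id t)) =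
        M.coact (BalTensor.contractRight f.toLin (tensorGalois 𝒞 x hM t)) -
          BalTensor.map LinearMap.id (Comod.actLin f) (tensorGalois 𝒞 x hM t) := by
    intro f t
    induction t using BalTensor.induction_on with
    | zero => simp
    | add s t hs ht => simp only [map_add, hs, ht]; abel
    | tmul m a =>
      rw [tensorGalois_tmul, BalTensor.map_tmul, tensorGalois_tmul, BalTensor.contractRight_tmul,
        BalTensor.contractRight_tmul, BalTensor.map_tmul, LinearMap.id_apply, LinearMap.id_apply,
        hact, M.coact.map_smul, ← BalTensor.right_smul_tmul]
      exact smul_sub _ _ _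
  have h0 : BalTensor.map d LinearMap.id t = 0 := by
    apply tensorGalois_injective hMC hβ
    refine hC.ext_dual fun f : 𝒞.Dual => ?_
    rw [key, ht, map_zero, map_zero, sub_eq_zero]
    exact M.coact_act f m
  obtain ⟨v, rfl⟩ := hflat.exists_map_eq_of_exact ι d
    (fun m hm => ⟨⟨m, sub_eq_zero.1 hm⟩, rfl⟩) t h0
  refine ⟨v, ?_⟩
  rw [← M.counit m, ← ht]
  clear ht h0
  induction v using BalTensor.induction_on with
  | zero => simp
  | add s t hs ht => simp only [map_add, hs, ht]
  | tmul n a =>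
    change op a • (n : M) = op (𝒞.counit (op a • x)) • (n : M)
    rw [𝒞.counit_op_smul, hx.counit_eq, op_smul_eq_mul, one_mul]

/-- Under the equality `σ[C] = Gen(A)`, submodules of direct sums of copies of `A` are
`A`-generated. -/
theorem gen_submodule_of_subgen_eq (hx : 𝒞.IsGrouplike x)
    (h : Subgen (Comod.regular 𝒞).toModule = Gen (𝒞.base hx).toModule) (J : Type u)
    (K : Submodule 𝒞.Dualᵐᵒᵖ (J →₀ (𝒞.base hx).toModule)) :
    Gen (𝒞.base hx).toModule (ModuleCat.of _ K) := by
  rw [← h]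
  exact ((𝒞.base hx).subgen_regular.finsupp J).of_injective (X := ModuleCat.of _ K) K.subtype
    K.injective_subtype

theorem subgen_base_eq_of_subgen_eq (hx : 𝒞.IsGrouplike x)
    (h : Subgen (Comod.regular 𝒞).toModule = Gen (𝒞.base hx).toModule) :
    Subgen (Comod.regular 𝒞).toModule = Subgen (𝒞.base hx).toModule := by
  refine le_antisymm (fun X hX => ?_) fun X hX => ?_
  · rw [h] at hX
    exact hX.subgen
  · obtain ⟨Y, i, hY, hi⟩ := hX
    rw [← h] at hY
    exact hY.of_injective i hi

/-- By `gen_of_subgen`, the class `Gen(A)` is already closed under submodules, so it equals `σ[A]`.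
-/
theorem subgen_eq_of_evalMap_bijective (hx : 𝒞.IsGrouplike x)
    (hflat : LeftFlat (𝒞.coinvariants x) A)
    (hσ : Subgen (Comod.regular 𝒞).toModule = Subgen (𝒞.base hx).toModule)
    (hbij : ∀ X, Gen (𝒞.base hx).toModule X → Function.Bijective (evalMap hx X)) :
    Subgen (Comod.regular 𝒞).toModule = Gen (𝒞.base hx).toModule := by
  rw [hσ]
  exact le_antisymm (fun X hX => gen_of_subgen hx hflat hbij hX) fun X hX => hX.subgen

theorem subgen_eq_of_isSeparator (hC : LocallyProjective A C) (hx : 𝒞.IsGrouplike x)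
    (h : IsSeparator (𝒞.base hx)) :
    Subgen (Comod.regular 𝒞).toModule = Gen (𝒞.base hx).toModule :=
  le_antisymm (fun _ hX => gen_of_isSeparator hC hx h hX)
    fun _ hX => Subgen.of_gen hX (𝒞.base hx).subgen_regular

theorem psi'_bijective_of_subgen_eq (hC : LocallyProjective A C) (hx : 𝒞.IsGrouplike x)
    (h : Subgen (Comod.regular 𝒞).toModule = Gen (𝒞.base hx).toModule) (M : Comod 𝒞) :
    Function.Bijective (M.psi' hx) := by
  rw [psi'_bijective_iff hC]
  refine ⟨evalMap_injective_of_gen hC hx (gen_submodule_of_subgen_eq hx h) _,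
    (evalMap_surjective_iff hx _).2 ?_⟩
  rw [← h]
  exact M.subgen_regular

end Structure

/-! ### The equivalences -/

theorem mainTheorem3 {A : Type u} [Ring A] [Nontrivial A] {C : Type u} [AddCommGroup C]
    [Module A C] [Module Aᵐᵒᵖ C] [SMulCommClass A Aᵐᵒᵖ C]
    (𝒞 : Coring A C) (x : C) (hx : 𝒞.IsGrouplike x) (hC : LocallyProjective A C) :
    List.TFAE [
      𝒞.WeakStructureTheorem x,
      LeftFlat (𝒞.coinvariants x) A ∧ 𝒞.IsGalois x,
      LeftFlat (𝒞.coinvariants x) A ∧ Function.Bijective ((Comod.regular 𝒞).psi' hx),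
      LeftFlat (𝒞.coinvariants x) A ∧
        Subgen (Comod.regular 𝒞).toModule = Subgen (𝒞.base hx).toModule ∧
        ∀ M : Comod 𝒞, Gen (𝒞.base hx).toModule M.toModule → Function.Bijective (M.psi' hx),
      ∀ M : Comod 𝒞, Function.Bijective (M.psi' hx),
      Subgen (Comod.regular 𝒞).toModule = Gen (𝒞.base hx).toModule,
      LeftFlat (𝒞.coinvariants x) A ∧
        Subgen (Comod.regular 𝒞).toModule = Subgen (𝒞.base hx).toModule ∧
        ((Gen (𝒞.base hx).toModule).ι ⋙ 𝒞.moduleHomFunctor hx).Full ∧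
        ((Gen (𝒞.base hx).toModule).ι ⋙ 𝒞.moduleHomFunctor hx).Faithful,
      (𝒞.homFunctor hx).Faithful,
      IsSeparator (𝒞.base hx)] := by
  have hflat : Subgen (Comod.regular 𝒞).toModule = Gen (𝒞.base hx).toModule →
      LeftFlat (𝒞.coinvariants x) A := fun h =>
    leftFlat_of_gen hC hx (gen_submodule_of_subgen_eq hx h)
  have heval : Subgen (Comod.regular 𝒞).toModule = Gen (𝒞.base hx).toModule →
      ∀ X, Gen (𝒞.base hx).toModule X → Function.Bijective (evalMap hx X) := fun h X hX =>
    ⟨evalMap_injective_of_gen hC hx (gen_submodule_of_subgen_eq hx h) X,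
      (evalMap_surjective_iff hx X).2 hX⟩
  tfae_have 1 ↔ 5 := forall_congr' fun M => psi_bijective_iff hx M
  tfae_have 2 ↔ 3 := and_congr_right fun _ => Coring.isGalois_iff_psi'_bijective hx
  tfae_have 8 ↔ 9 := (isSeparator_iff_faithful_homFunctor hx).symm
  tfae_have 9 → 6 := subgen_eq_of_isSeparator hC hx
  tfae_have 5 → 9 := fun h => isSeparator_of_psi'_surjective hx fun M => (h M).2
  tfae_have 6 → 5 := psi'_bijective_of_subgen_eq hC hx
  tfae_have 6 → 3 := fun h => ⟨hflat h, psi'_bijective_of_subgen_eq hC hx h _⟩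
  tfae_have 6 → 4 := fun h => ⟨hflat h, subgen_base_eq_of_subgen_eq hx h,
    fun M _ => psi'_bijective_of_subgen_eq hC hx h M⟩
  tfae_have 6 → 7 := fun h => ⟨hflat h, subgen_base_eq_of_subgen_eq hx h,
    full_of_evalMap_bijective hx (heval h), faithful_moduleHomFunctor hx⟩
  tfae_have 7 → 6 := fun ⟨h1, h2, h3, _⟩ => subgen_eq_of_evalMap_bijective hx h1 h2 fun X hX =>
    ⟨evalMap_injective_of_full hx h3 X hX, (evalMap_surjective_iff hx X).2 hX⟩
  tfae_have 4 → 6 := fun ⟨h1, h2, h3⟩ => subgen_eq_of_evalMap_bijective hx h1 h2 fun X hX => by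
    -- The hypothesis concerns comodules only; an `A`-generated module lies in `σ[A] = σ[C]` and is
    -- therefore isomorphic to one.
    obtain ⟨M, ⟨e⟩⟩ := exists_equiv_of_subgen hC (X := X) (by rw [h2]; exact hX.subgen)
    rw [evalMap_bijective_iff_of_equiv hx e, ← psi'_bijective_iff hC]
    exact h3 M (hX.of_surjective e.toLinearMap e.surjective)
  tfae_have 2 → 9 := fun ⟨h1, h2⟩ => isSeparator_of_psi'_surjective hx fun M => by
    rw [← psi_comp_homFunctorEquivCoinvariants, AddMonoidHom.coe_comp]
    exact (psi_surjective_of_isGalois hC hx h1 h2 M).comp (BalTensor.map_bijective _).2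
  tfae_finish
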